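/- Let $d\ge 1$ and $b\ge 0$ be integers, $\mathcal S_b=\{p\in\mathbb N^d:|p|=p_1+\dots+p_d\le b\}$, $N_b=\#\mathcal S_b$, and $U(z)=(z^p)_{p\in\mathcal S_b}$ with $z^p=\prod_j z_j^{p_j}$. Let $K:\mathbb R^d\to\mathbb R_+$ be a bounded measurable kernel that vanishes outside $[-\frac12,\frac12]^d$, with $\int K=1$ and $K_\infty=\sup K$; let $\lambda$ be the smallest eigenvalue of $\int_{[-1/2,1/2]^d}U(x)U(x)^\top K(x)\,dx$, and $$\Sigma=2+2\sum_{l\ge1}d^2\,10^{2l-1}\exp\Big\{-\frac{18\cdot10^l}{\pi^4l^4}\,\frac{(8K_\infty)^{-1}}{K_\infty+1/3}\Big\}.$$ Let $\rho:\mathbb R\to\mathbb R_+$ be even, convex and differentiable with $\rho(0)=0$, $\rho'$ 1-Lipschitz and $\dot\rho_\infty=\sup|\rho'|<\infty$ (so $\rho''$ exists almost everywhere), and let $L_\rho,\alpha,c>0$. Then there is $\delta>0$, depending only on these data ($d,b,K,\rho,L_\rho,\alpha,c$), such that the following holds for all $n\ge1$, all symmetric probability densities $g_1,\dots,g_n$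 on $\mathbb R$ that are monotone on the positive half-line and satisfy $\min_i\int\rho''g_i\ge c$ and $$\max_i\int_{\mathbb R}|\rho''(z+u)-\rho''(z+v)|\,g_i(z)\,dz\le L_\rho|u-v|^\alpha\qquad(u,v\in\mathbb R),$$ all $h>n^{-1/d}$, $M>0$, and all $x_0\in[0,1]^d$ such that the kernel window lies in the cube, that is, $x_0+hz\in[0,1]^d$ whenever $K(z)\ne0$. Let $V=\prod_j[x_{0,j}-\frac h2,x_{0,j}+\frac h2]\cap[0,1]^d$, $\Theta(M)=\{t\in\mathbb R^{N_b}:\|t\|_1\le M\}$ and $f_t(x)=\sum_{p\in\mathcal S_b}t_p\big(\frac{x-x_0}h\big)^p\mathbf 1_V(x)$. For measurable $f:[0,1]^d\to\mathbb R$ let $\theta=(\theta_p)_{p\in\mathcal S_b}$ with $\theta_p=\partial^pf(x_0)\,h^{|p|}/(p_1!\cdots p_d!)$, where $\theta_p=0$ if $\partial^pf(x_0)$ does not exist (so $\theta_0=f(x_0)$), and let $b_h=\sup_{x\in V}|f(x)-f_\theta(x)|$. Assume $\|\theta\|_1\le M$ and $b_h<\infty$. Let $X_1,\dots,X_n$ be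 independent and uniform on $[0,1]^d$, let $\xi_1,\dots,\xi_n$ be independent, $\xi_i$ with density $g_i$, and independent of the family $(X_i)$, and let $Y_i=f(X_i)+\xi_i$. Let $\hat\theta(h)$ be any minimizer over $t\in\Theta(M)$ of $$\frac1{nh^d}\sum_{i=1}^n\rho\big(Y_i-f_t(X_i)\big)K\Big(\frac{X_i-x_0}h\Big),$$ and $\hat f^h(x_0)=\hat\theta_{0,\dots,0}(h)$. Then for every $\varepsilon\ge\frac{4N_b}{c\lambda}\big(1\vee b_h\sqrt{nh^d}\big)$, $$\mathbb P\Big(\sqrt{nh^d}\,\big|\hat f^h(x_0)-f(x_0)\big|\ge\varepsilon,\ \|\hat\theta(h)-\theta\|_2\le\delta\Big)\le N_b\,\Sigma\,\exp\left\{-\frac{\Big(\frac{c\lambda}{2N_b}\varepsilon-\big(1\vee b_h\sqrt{nh^d}\big)\Big)^2}{8K_\infty^2(1\vee\dot\rho_\infty^2)+\frac{4K_\infty}{3N_b}(1\vee\dot\rho_\infty)\frac{c\lambda\varepsilon}{\sqrt{nh^d}}}\right\}.$$ -/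

import Mathlib

open MeasureTheory ProbabilityTheory Filter Topology

noncomputable section

namespace LocalM

/-- Multi-indices `p ∈ ℕ^d` with `|p| = p₁ + ⋯ + p_d ≤ b`. -/
def multiIdx (d b : ℕ) : Finset (Fin d → ℕ) :=
  (Fintype.piFinset fun _ => Finset.range (b + 1)).filter fun p => ∑ j, p j ≤ b

theorem mem_multiIdx {d b : ℕ} {p : Fin d → ℕ} : p ∈ multiIdx d b ↔ ∑ j, p j ≤ b := by
  simp only [multiIdx, Finset.mem_filter, Fintype.mem_piFinset, Finset.mem_range,
    and_iff_right_iff_imp]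
  intro hp j
  have := Finset.single_le_sum (f := p) (fun _ _ => Nat.zero_le _) (Finset.mem_univ j)
  omega

/-- The multi-index `(0, …, 0)`. -/
def zeroIdx (d b : ℕ) : multiIdx d b := ⟨0, by simp [mem_multiIdx]⟩

/-- The number `N_b` of multi-indices of length at most `b`. -/
def numIdx (d b : ℕ) : ℕ := (multiIdx d b).card

/-- The monomial `z^p = ∏ j, z_j ^ p_j`. -/
def monomial {d : ℕ} (p : Fin d → ℕ) (z : Fin d → ℝ) : ℝ := ∏ j, z j ^ p j

/-- The unit cube `[0,1]^d`. -/
def unitCube (d : ℕ) : Set (Fin d → ℝ) := Set.Icc 0 1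

/-- The neighbourhood `V_{x₀}(h) = ∏ j [x₀ⱼ - h/2, x₀ⱼ + h/2] ∩ [0,1]^d`. -/
def nbhd {d : ℕ} (x₀ : Fin d → ℝ) (h : ℝ) : Set (Fin d → ℝ) :=
  {x | ∀ j, x j ∈ Set.Icc (x₀ j - h / 2) (x₀ j + h / 2)} ∩ unitCube d

/-- The local polynomial `f_t(x) = ∑_p t_p ((x - x₀)/h)^p · 1_{V_{x₀}(h)}(x)`. -/
def localPoly {d b : ℕ} (x₀ : Fin d → ℝ) (h : ℝ) (t : multiIdx d b → ℝ) :
    (Fin d → ℝ) → ℝ :=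
  (nbhd x₀ h).indicator fun x => ∑ p, t p * monomial p.1 fun j => (x j - x₀ j) / h

/-- `Θ(M)`: the `ℓ¹` ball of radius `M` in `ℝ^{N_b}`. -/
def paramSet (d b : ℕ) (M : ℝ) : Set (multiIdx d b → ℝ) := {t | ∑ p, |t p| ≤ M}

/-- `B(θ, r) = {t ∈ Θ(M) : ‖t - θ‖₂ ≤ r}`. -/
def paramBall {d b : ℕ} (M : ℝ) (θ : multiIdx d b → ℝ) (r : ℝ) : Set (multiIdx d b → ℝ) :=
  {t | t ∈ paramSet d b M ∧ √(∑ p, (t p - θ p) ^ 2) ≤ r}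

/-- Sup-norm of a real-valued function (used for bounded functions only). -/
def supNorm {α : Type*} (φ : α → ℝ) : ℝ := ⨆ a, |φ a|

/-- Kernels: nonnegative bounded measurable functions vanishing outside `[-1/2,1/2]^d`,
with integral one. -/
structure IsKernel {d : ℕ} (K : (Fin d → ℝ) → ℝ) : Prop where
  measurable : Measurable K
  nonneg : ∀ z, 0 ≤ K z
  support_subset : Function.support K ⊆ {z | ∀ j, z j ∈ Set.Icc (-(1 / 2) : ℝ) (1 / 2)}
  bounded : BddAbove (Set.range fun z => |K z|)
  integral_eq_one : ∫ z, K z = 1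

/-- The part of the definition of a contrast function that does not involve the noise. -/
structure IsContrast (ρ : ℝ → ℝ) : Prop where
  nonneg : ∀ z, 0 ≤ ρ z
  symm : ∀ z, ρ (-z) = ρ z
  convex : ConvexOn ℝ Set.univ ρ
  zero : ρ 0 = 0
  differentiable : Differentiable ℝ ρ
  deriv_lipschitz : LipschitzWith 1 (deriv ρ)
  deriv_bounded : BddAbove (Set.range fun z => |deriv ρ z|)
  ae_second_deriv : ∀ᵐ z : ℝ, DifferentiableAt ℝ (deriv ρ) z

/-- The averaged Hölder condition on `ρ''`, with constants `L` and `α`, which a contrast function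
satisfies relative to the noise densities `g i`. -/
def SecondDerivHolder (ρ : ℝ → ℝ) (L α : ℝ) {n : ℕ} (g : Fin n → ℝ → ℝ) : Prop :=
  ∀ i, ∀ u v : ℝ,
    ∫ z, |deriv (deriv ρ) (z + u) - deriv (deriv ρ) (z + v)| * g i z ≤ L * |u - v| ^ α

/-- Symmetric probability densities on `ℝ` that are monotone (necessarily nonincreasing) on the
positive half-line; the value at `0` is left free. -/
structure IsSymmMonotoneDensity (g : ℝ → ℝ) : Prop where
  measurable : Measurable g
  nonneg : ∀ z, 0 ≤ g z
  lintegral_eq_one : ∫⁻ z, ENNReal.ofReal (g z) = 1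
  symm : ∀ z, g (-z) = g z
  antitoneOn : AntitoneOn g (Set.Ioi 0)

/-- `c(ρ, (g_i)) = inf_i ∫ ρ'' g_i`. -/
def noiseConst (ρ : ℝ → ℝ) {n : ℕ} (g : Fin n → ℝ → ℝ) : ℝ :=
  ⨅ i, ∫ z, deriv (deriv ρ) z * g i z

/-- The class `G_ρ^{(c)}` of families of noise densities. -/
def densityClass (ρ : ℝ → ℝ) (c : ℝ) (n : ℕ) : Set (Fin n → ℝ → ℝ) :=
  {g | (∀ i, IsSymmMonotoneDensity (g i)) ∧ c ≤ noiseConst ρ g}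

/-- Random design and noise: the `X i` are independent and uniform on `[0,1]^d`, the `ξ i` are
independent with densities `g i`, and the two families are independent of each other. -/
structure IsDesignNoise {Ω : Type*} [MeasurableSpace Ω] (P : Measure Ω) {d n : ℕ}
    (g : Fin n → ℝ → ℝ) (X : Fin n → Ω → Fin d → ℝ) (ξ : Fin n → Ω → ℝ) : Prop where
  measurable_design : ∀ i, Measurable (X i)
  measurable_noise : ∀ i, Measurable (ξ i)
  law_design : ∀ i, P.map (X i) = volume.restrict (unitCube d)
  law_noise : ∀ i, P.map (ξ i) = volume.withDensity fun z => ENNReal.ofReal (g i z)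
  indep_design : iIndepFun X P
  indep_noise : iIndepFun ξ P
  indep : IndepFun (fun ω i => X i ω) (fun ω i => ξ i ω) P

/-- The local criterion `π̃_h(t) = (n h^d)⁻¹ ∑ i, ρ(Y_i - f_t(X_i)) K((X_i - x₀)/h)`. -/
def criterion {d b n : ℕ} (ρ : ℝ → ℝ) (K : (Fin d → ℝ) → ℝ) (x₀ : Fin d → ℝ) (h : ℝ)
    (x : Fin n → Fin d → ℝ) (y : Fin n → ℝ) (t : multiIdx d b → ℝ) : ℝ :=
  1 / (n * h ^ d) *
    ∑ i, ρ (y i - localPoly x₀ h t (x i)) * K fun j => (x i j - x₀ j) / h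

/-- `s` is a minimizer of the local criterion over `Θ(M)`. -/
def IsLocalMEstimate {d b n : ℕ} (ρ : ℝ → ℝ) (K : (Fin d → ℝ) → ℝ) (M : ℝ) (x₀ : Fin d → ℝ)
    (h : ℝ) (x : Fin n → Fin d → ℝ) (y : Fin n → ℝ) (s : multiIdx d b → ℝ) : Prop :=
  s ∈ paramSet d b M ∧ ∀ t ∈ paramSet d b M, criterion ρ K x₀ h x y s ≤ criterion ρ K x₀ h x y t

/-- First partial derivative in direction `j` of a function on `[0,1]^d` (one-sided on the faces). -/
def partialDeriv {d : ℕ} (j : Fin d) (φ : (Fin d → ℝ) → ℝ) (x : Fin d → ℝ) : ℝ :=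
  derivWithin (fun s => φ (Function.update x j s)) (Set.Icc 0 1) (x j)

/-- Iterated partial derivative `∂_{j₁} ∂_{j₂} ⋯ f` along a list of directions. -/
def iterPartial {d : ℕ} : List (Fin d) → ((Fin d → ℝ) → ℝ) → (Fin d → ℝ) → ℝ
  | [], f => f
  | j :: l, f => partialDeriv j (iterPartial l f)

/-- Existence at `x` of the iterated partial derivative: the inner derivative exists at all nearby
points of the coordinate line in `[0,1]^d` and is differentiable along this line at `x`. -/
def IterPartialExists {d : ℕ} : List (Fin d) → ((Fin d → ℝ) → ℝ) → (Fin d → ℝ) → Prop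
  | [], _, _ => True
  | j :: l, f, x =>
    (∀ᶠ s in 𝓝[Set.Icc 0 1] (x j), IterPartialExists l f (Function.update x j s)) ∧
      DifferentiableWithinAt ℝ (fun s => iterPartial l f (Function.update x j s))
        (Set.Icc 0 1) (x j)

/-- The directions `1, …, 1, 2, …, 2, …, d, …, d` with `j` repeated `p_j` times. -/
def directions {d : ℕ} (p : Fin d → ℕ) : List (Fin d) :=
  (List.finRange d).flatMap fun j => List.replicate (p j) j

open Classical in
/-- Taylor coefficients `θ_p = ∂^p f(x₀) h^{|p|} / p!`, with `θ_p = 0` if `∂^p f(x₀)` does not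
exist. For `p = 0` this is `f(x₀)`. -/
def taylorCoeff {d b : ℕ} (f : (Fin d → ℝ) → ℝ) (x₀ : Fin d → ℝ) (h : ℝ) :
    multiIdx d b → ℝ := fun p =>
  if IterPartialExists (directions p.1) f x₀ then
    iterPartial (directions p.1) f x₀ * h ^ (∑ j, p.1 j) / ∏ j, ((p.1 j).factorial : ℝ)
  else 0

/-- The absolute approximation error `|f(x) - f_θ(x)|` on `V_{x₀}(h)`. -/
def biasValues {d : ℕ} (b : ℕ) (f : (Fin d → ℝ) → ℝ) (x₀ : Fin d → ℝ) (h : ℝ) : Set ℝ :=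
  (fun x => |f x - localPoly x₀ h (taylorCoeff (b := b) f x₀ h) x|) '' nbhd x₀ h

/-- The bias `b_h = sup_{x ∈ V_{x₀}(h)} |f(x) - f_θ(x)|` (used when it is finite). -/
def bias {d : ℕ} (b : ℕ) (f : (Fin d → ℝ) → ℝ) (x₀ : Fin d → ℝ) (h : ℝ) : ℝ :=
  sSup (biasValues b f x₀ h)

/-- The matrix `∫_{[-1/2,1/2]^d} U(x) U(x)ᵀ K(x) dx`, where `U` is the vector of monomials. -/
def momentMatrix {d : ℕ} (b : ℕ) (K : (Fin d → ℝ) → ℝ) :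
    Matrix (multiIdx d b) (multiIdx d b) ℝ := fun p q =>
  ∫ x in {z : Fin d → ℝ | ∀ j, z j ∈ Set.Icc (-(1 / 2) : ℝ) (1 / 2)},
    monomial p.1 x * monomial q.1 x * K x

/-- `λ`: the smallest eigenvalue of the moment matrix. -/
def minEigen {d : ℕ} (b : ℕ) (K : (Fin d → ℝ) → ℝ) : ℝ := sInf (spectrum ℝ (momentMatrix b K))

/-- `Σ = 2 + 2 ∑_{l ≥ 1} d² 10^{2l-1} exp(-(18·10^l)/(π⁴ l⁴) · (8K∞)⁻¹/(K∞ + 1/3))`. -/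
def sigmaConst (d : ℕ) (Kinf : ℝ) : ℝ :=
  2 + 2 * ∑' k : ℕ, (d : ℝ) ^ 2 * 10 ^ (2 * (k + 1) - 1) *
    Real.exp (-((18 * 10 ^ (k + 1)) / (Real.pi ^ 4 * ((k : ℝ) + 1) ^ 4) *
      ((8 * Kinf)⁻¹ / (Kinf + 1 / 3))))

/-- The right-hand side of the deviation inequality: `N = N_b`, `S = Σ`, `lam = λ`,
`Kinf = ‖K‖_∞`, `rinf = ‖ρ'‖_∞`, `m = n h^d`, `bh = b_h`. -/
def deviationBound (N S c lam Kinf rinf m bh ε : ℝ) : ℝ :=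
  N * S * Real.exp (-((c * lam / (2 * N) * ε - max 1 (bh * √m)) ^ 2 /
    (8 * Kinf ^ 2 * max 1 (rinf ^ 2) +
      4 * Kinf / (3 * N) * max 1 rinf * (c * lam * ε / √m))))

end LocalM

end


/-!
Write `m = n h^d`. Since `ρ` is convex and the minimizer `t` lies in the convex set `Θ(M)`, which
contains `θ`, the derivative of the criterion in the direction `t - θ` is nonpositive on the whole
segment from `θ` to `t`. Evaluate it at the point `θ + s` of this segment at distance `r = ε / √m`
from `θ`: the empirical score in the direction `s` is nonnegative there. Its mean, however, is at
most `m (β ‖s‖₁ - (c / 2) λ ‖s‖₂²)`, because the averaged score `w ↦ ∫ ρ'(z + w) g(z) dz` has slope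
at least `c / 2` near `0`, `β` bounds the bias, and `λ` is the smallest eigenvalue of the moment
matrix. Hence some coordinate of the centred score at `θ + s` is of size `√m (γ ε - β √m)`, where
`γ = c λ / (2 N_b)`.

The direction of `s` is random, but it lies close to a finite net of the sphere. So either the
number of design points in the window is exceptionally large, or the centred score at `θ` is of size
half that bound, or its increment from `θ` to a net point `θ + r v` is of size a quarter of it.
Bernstein's inequality bounds the probabilities. Only the first two kinds of event cost more than a
negligible amount: on the event `‖t - θ‖₂ ≤ δ` we may assume `r ≤ δ`, so the increments have
variance of order `δ²`, and a small `δ` compensates for the cardinality of the net. The total is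
`2 + 4 N_b ≤ 6 N_b` times the exponential, and already `6 ≤ Σ`.
-/

open scoped Matrix

noncomputable section

namespace LocalM

/-! ### Bernstein's inequality -/

theorem exp_le_one_add_add_sq {x s : ℝ} (hx : |x| ≤ s) (hs : s < 3) :
    Real.exp x ≤ 1 + x + x ^ 2 / (2 * (1 - s / 3)) := by
  have hs0 : 0 ≤ s := (abs_nonneg x).trans hx
  have hterm (k : ℕ) : x ^ (k + 2) / ((k + 2).factorial : ℝ) ≤ x ^ 2 / 2 * (s / 3) ^ k := by
    have hfactorial : (2 * 3 ^ k : ℝ) ≤ ((k + 2).factorial : ℝ) := by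
      rw [add_comm k 2]
      exact_mod_cast Nat.factorial_mul_pow_le_factorial (m := 2) (n := k)
    calc x ^ (k + 2) / ((k + 2).factorial : ℝ)
        ≤ x ^ 2 * s ^ k / (2 * 3 ^ k) := by
          have hpow : x ^ k ≤ s ^ k := (le_abs_self _).trans (by rw [abs_pow]; gcongr)
          rw [pow_add, mul_comm]
          gcongr
      _ = x ^ 2 / 2 * (s / 3) ^ k := by rw [div_pow]; field_simp
  have hgeom : HasSum (fun k : ℕ => x ^ 2 / 2 * (s / 3) ^ k) (x ^ 2 / 2 * (1 - s / 3)⁻¹) :=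
    (hasSum_geometric_of_lt_one (by positivity) (by linarith)).mul_left _
  have hexp : HasSum (fun k : ℕ => x ^ k / (k.factorial : ℝ)) (Real.exp x) := by
    simpa only [Real.exp_eq_exp_ℝ] using NormedSpace.expSeries_div_hasSum_exp x
  have htail := hasSum_le hterm ((hasSum_nat_add_iff' 2).2 hexp) hgeom
  simp only [Finset.sum_range_succ, Finset.sum_range_zero, pow_zero, pow_one, Nat.factorial,
    Nat.cast_one, div_one, zero_add, mul_one] at htail
  rw [div_mul_eq_div_div, div_eq_mul_inv (x ^ 2 / 2)]
  linarith

section Bernstein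

variable {Ω : Type*} [MeasurableSpace Ω] {P : Measure Ω} [IsProbabilityMeasure P] {B : ℝ}

theorem mgf_le_exp_mul_integral_sq {Y : Ω → ℝ} (hY : AEMeasurable Y P)
    (hB : ∀ᵐ ω ∂P, |Y ω| ≤ B) (h0 : ∫ ω, Y ω ∂P = 0) {u : ℝ} (hu : 0 ≤ u) (huB : u * B < 3) :
    mgf Y P u ≤ Real.exp (u ^ 2 / (2 * (1 - u * B / 3)) * ∫ ω, Y ω ^ 2 ∂P) := by
  set κ := u ^ 2 / (2 * (1 - u * B / 3))
  have hYi : Integrable Y P := .of_bound hY.aestronglyMeasurable B hB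
  have hY2 : Integrable (fun ω => Y ω ^ 2) P := by
    refine .of_bound (hY.pow_const 2).aestronglyMeasurable (B ^ 2) ?_
    filter_upwards [hB] with ω hω
    rw [Real.norm_eq_abs, abs_pow]
    gcongr
  have hlin : Integrable (fun ω => 1 + u * Y ω) P := (integrable_const 1).add (hYi.const_mul u)
  calc mgf Y P u ≤ ∫ ω, (1 + u * Y ω + κ * Y ω ^ 2) ∂P := by
        refine integral_mono_of_nonneg (ae_of_all _ fun ω => (Real.exp_pos _).le)
          (hlin.add (hY2.const_mul κ)) ?_
        filter_upwards [hB] with ω hω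
        have huY : |u * Y ω| ≤ u * B := by rw [abs_mul, abs_of_nonneg hu]; gcongr
        exact (exp_le_one_add_add_sq huY huB).trans_eq (by ring)
    _ = κ * ∫ ω, Y ω ^ 2 ∂P + 1 := by
        rw [integral_add hlin (hY2.const_mul κ),
          integral_add (integrable_const 1) (hYi.const_mul u), integral_const_mul,
          integral_const_mul, h0, integral_const, probReal_univ]
        simp [add_comm]
    _ ≤ _ := Real.add_one_le_exp _

variable {ι : Type*} [Fintype ι] {V t : ℝ}

theorem bernstein_sum_ge {Y : ι → Ω → ℝ} (hind : iIndepFun Y P) (hY : ∀ i, Measurable (Y i))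
    (hB0 : 0 ≤ B) (hB : ∀ i, ∀ᵐ ω ∂P, |Y i ω| ≤ B) (h0 : ∀ i, ∫ ω, Y i ω ∂P = 0)
    (hV0 : 0 < V) (hV : ∑ i, ∫ ω, Y i ω ^ 2 ∂P ≤ V) (ht : 0 ≤ t) :
    P.real {ω | t ≤ ∑ i, Y i ω} ≤ Real.exp (-(t ^ 2 / (2 * (V + B * t / 3)))) := by
  set W := V + B * t / 3 with hW
  have hWpos : 0 < W := by positivity
  set u := t / W with hu
  have hu0 : 0 ≤ u := by positivity
  have huB : u * B < 3 := by
    rw [hu, div_mul_eq_mul_div, div_lt_iff₀ hWpos, hW]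
    linarith
  have hfac : 1 - u * B / 3 = V / W := by
    rw [hu, eq_div_iff hWpos.ne']
    field_simp
    rw [hW]
    ring
  have hint : Integrable (fun ω => Real.exp (u * (∑ i, Y i) ω)) P :=
    hind.integrable_exp_mul_sum hY fun i _ =>
      integrable_exp_mul_of_le u B hu0 (hY i).aemeasurable
        ((hB i).mono fun ω hω => (le_abs_self _).trans hω)
  calc P.real {ω | t ≤ ∑ i, Y i ω}
      = P.real {ω | t ≤ (∑ i, Y i) ω} := by simp only [Finset.sum_apply]
    _ ≤ Real.exp (-u * t) * mgf (∑ i, Y i) P u := measure_ge_le_exp_mul_mgf t hu0 hint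
    _ = Real.exp (-u * t) * ∏ i, mgf (Y i) P u := by rw [hind.mgf_sum hY Finset.univ]
    _ ≤ Real.exp (-u * t) *
          ∏ i, Real.exp (u ^ 2 / (2 * (V / W)) * ∫ ω, Y i ω ^ 2 ∂P) := by
        gcongr with i
        · exact fun i _ => mgf_nonneg
        · exact hfac ▸ mgf_le_exp_mul_integral_sq (hY i).aemeasurable (hB i) (h0 i) hu0 huB
    _ = Real.exp (-u * t + u ^ 2 / (2 * (V / W)) * ∑ i, ∫ ω, Y i ω ^ 2 ∂P) := by
        rw [← Real.exp_sum, ← Finset.mul_sum, ← Real.exp_add]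
    _ ≤ Real.exp (-u * t + u ^ 2 / (2 * (V / W)) * V) := by gcongr
    _ = Real.exp (-(t ^ 2 / (2 * W))) := by
        congr 1
        rw [hu]
        field_simp
        ring

theorem bernstein_abs_sum_ge {Y : ι → Ω → ℝ} (hind : iIndepFun Y P) (hY : ∀ i, Measurable (Y i))
    (hB0 : 0 ≤ B) (hB : ∀ i, ∀ᵐ ω ∂P, |Y i ω| ≤ B) (h0 : ∀ i, ∫ ω, Y i ω ∂P = 0)
    (hV0 : 0 < V) (hV : ∑ i, ∫ ω, Y i ω ^ 2 ∂P ≤ V) (ht : 0 ≤ t) :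
    P.real {ω | t ≤ |∑ i, Y i ω|} ≤ 2 * Real.exp (-(t ^ 2 / (2 * (V + B * t / 3)))) := by
  have hpos := bernstein_sum_ge hind hY hB0 hB h0 hV0 hV ht
  have hneg := bernstein_sum_ge (Y := fun i ω => -Y i ω)
    (hind.comp (fun _ y => -y) fun _ => measurable_neg) (fun i => (hY i).neg) hB0
    (by simpa only [abs_neg] using hB) (fun i => by rw [integral_neg, h0, neg_zero]) hV0
    (by simpa only [neg_sq] using hV) ht
  simp only [Finset.sum_neg_distrib] at hneg
  calc P.real {ω | t ≤ |∑ i, Y i ω|}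
      = P.real ({ω | t ≤ ∑ i, Y i ω} ∪ {ω | t ≤ -∑ i, Y i ω}) := by
        simp only [le_abs, Set.ofPred_or]
    _ ≤ _ := (measureReal_union_le _ _).trans (by linarith)

end Bernstein

/-! ### Independence of pairs -/

theorem iIndepFun_prodMk {Ω ι E F : Type*} [MeasurableSpace Ω] {P : Measure Ω}
    [Finite ι] [MeasurableSpace E] [MeasurableSpace F]
    {X : ι → Ω → E} {ξ : ι → Ω → F} (mX : ∀ i, Measurable (X i)) (mξ : ∀ i, Measurable (ξ i))
    (hX : iIndepFun X P) (hξ : iIndepFun ξ P)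
    (hXξ : IndepFun (fun ω i => X i ω) (fun ω i => ξ i ω) P) :
    iIndepFun (fun i ω => (X i ω, ξ i ω)) P := by
  have _ := Fintype.ofFinite ι
  have _ := hX.isProbabilityMeasure
  have hpair (i : ι) : P.map (fun ω => (X i ω, ξ i ω)) = (P.map (X i)).prod (P.map (ξ i)) :=
    (indepFun_iff_map_prod_eq_prod_map_map (mX i).aemeasurable (mξ i).aemeasurable).1
      (hXξ.comp (measurable_pi_apply i) (measurable_pi_apply i))
  have _ (i : ι) : IsProbabilityMeasure (P.map (X i)) :=
    Measure.isProbabilityMeasure_map (mX i).aemeasurable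
  have _ (i : ι) : IsProbabilityMeasure (P.map (ξ i)) :=
    Measure.isProbabilityMeasure_map (mξ i).aemeasurable
  rw [iIndepFun_iff_map_fun_eq_pi_map fun i => ((mX i).prodMk (mξ i)).aemeasurable]
  simp only [hpair]
  rw [← (measurePreserving_arrowProdEquivProdArrow E F ι (fun i => P.map (X i))
    fun i => P.map (ξ i)).symm.map_eq,
    ← (iIndepFun_iff_map_fun_eq_pi_map fun i => (mX i).aemeasurable).1 hX,
    ← (iIndepFun_iff_map_fun_eq_pi_map fun i => (mξ i).aemeasurable).1 hξ,
    ← (indepFun_iff_map_prod_eq_prod_map_map (by fun_prop) (by fun_prop)).1 hXξ,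
    Measure.map_map (MeasurableEquiv.measurable _) (by fun_prop)]
  rfl

/-! ### The moment matrix -/

theorem ae_eval_ne_zero : ∀ {d : ℕ} {q : MvPolynomial (Fin d) ℝ}, q ≠ 0 →
    ∀ᵐ x : Fin d → ℝ, MvPolynomial.eval x q ≠ 0
  | 0, q, hq => by
    refine ae_of_all _ fun x hx => hq ?_
    rw [MvPolynomial.eq_C_of_isEmpty q] at hx ⊢
    simpa using hx
  | d + 1, q, hq => by
    have hmeas : MeasurableSet
        {y : ℝ × (Fin d → ℝ) | MvPolynomial.eval (Fin.cons y.1 y.2) q ≠ 0} := by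
      have hcons : Continuous fun y : ℝ × (Fin d → ℝ) => (Fin.cons y.1 y.2 : Fin (d + 1) → ℝ) :=
        continuous_fst.finCons (A := fun _ => ℝ) continuous_snd
      exact (isOpen_ne_fun ((MvPolynomial.continuous_eval q).comp hcons)
        continuous_const).measurableSet
    have hlead : (MvPolynomial.finSuccEquiv ℝ d q).leadingCoeff ≠ 0 := by simpa using hq
    -- Off the zero set of the leading coefficient there are finitely many roots on each line.
    have hline : ∀ᵐ x : Fin d → ℝ, ∀ᵐ s : ℝ, MvPolynomial.eval (Fin.cons s x) q ≠ 0 := by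
      filter_upwards [ae_eval_ne_zero hlead] with x hx
      have hmap : (MvPolynomial.finSuccEquiv ℝ d q).map (MvPolynomial.eval x) ≠ 0 := fun h0 =>
        hx (by rw [Polynomial.leadingCoeff, ← Polynomial.coeff_map, h0, Polynomial.coeff_zero])
      have hroots := Polynomial.finite_setOfPred_isRoot hmap
      filter_upwards [hroots.countable.ae_notMem volume] with s hs
      rwa [MvPolynomial.eval_eq_eval_mv_eval']
    have hprod : ∀ᵐ y : ℝ × (Fin d → ℝ), MvPolynomial.eval (Fin.cons y.1 y.2) q ≠ 0 :=
      (Measure.ae_prod_iff_ae_ae hmeas).2 ((Measure.ae_ae_comm hmeas).2 hline)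
    filter_upwards [(volume_preserving_piFinSuccAbove (fun _ : Fin (d + 1) => ℝ)
      0).quasiMeasurePreserving.ae hprod] with x hx
    convert hx using 3
    simp [MeasurableEquiv.piFinSuccAbove, Fin.insertNthEquiv]

/-- The polynomial `∑ p, t p * z ^ p`, that is `U(z)ᵀ t` for the vector `U` of monomials. -/
def polyVal {d b : ℕ} (t : multiIdx d b → ℝ) (z : Fin d → ℝ) : ℝ := ∑ p, t p * monomial p.1 z

section Polynomial

variable {d b : ℕ} {t : multiIdx d b → ℝ} {z : Fin d → ℝ}

theorem ae_polyVal_ne_zero (ht : t ≠ 0) : ∀ᵐ z, polyVal t z ≠ 0 := by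
  let q : MvPolynomial (Fin d) ℝ :=
    ∑ p : multiIdx d b, MvPolynomial.monomial (Finsupp.equivFunOnFinite.symm p.1) (t p)
  have hq : q ≠ 0 := by
    obtain ⟨p, hp⟩ := Function.ne_iff.1 ht
    refine MvPolynomial.ne_zero_iff.2 ⟨Finsupp.equivFunOnFinite.symm p.1, ?_⟩
    simpa [q, MvPolynomial.coeff_sum, MvPolynomial.coeff_monomial, ← Subtype.ext_iff] using hp
  filter_upwards [ae_eval_ne_zero hq] with z hz
  convert hz using 1
  simp [polyVal, q, monomial, MvPolynomial.eval_monomial, Finsupp.prod_fintype]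

theorem abs_monomial_le_one (p : Fin d → ℕ) (hz : ∀ j, |z j| ≤ 1) : |monomial p z| ≤ 1 := by
  simp only [monomial, Finset.abs_prod, abs_pow]
  exact Finset.prod_le_one (fun _ _ => by positivity) fun j _ =>
    pow_le_one₀ (abs_nonneg _) (hz j)

theorem abs_polyVal_le (t : multiIdx d b → ℝ) (hz : ∀ j, |z j| ≤ 1) :
    |polyVal t z| ≤ ∑ p, |t p| := by
  refine (Finset.abs_sum_le_sum_abs _ _).trans (Finset.sum_le_sum fun p _ => ?_)
  rw [abs_mul]
  exact mul_le_of_le_one_right (abs_nonneg _) (abs_monomial_le_one _ hz)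

theorem polyVal_sub (s t : multiIdx d b → ℝ) (z : Fin d → ℝ) :
    polyVal (s - t) z = polyVal s z - polyVal t z := by
  simp only [polyVal, Pi.sub_apply, sub_mul, Finset.sum_sub_distrib]

@[fun_prop]
theorem measurable_monomial (p : Fin d → ℕ) : Measurable (monomial p) := by
  unfold monomial
  fun_prop

@[fun_prop]
theorem measurable_polyVal (t : multiIdx d b → ℝ) : Measurable (polyVal t) := by
  unfold polyVal
  fun_prop

end Polynomial

namespace IsKernel

variable {d b : ℕ} {K : (Fin d → ℝ) → ℝ}

theorem abs_coord_le_one (hK : IsKernel K) {z : Fin d → ℝ} (hz : K z ≠ 0) (j : Fin d) :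
    |z j| ≤ 1 :=
  abs_le.2 ⟨by linarith [(hK.support_subset hz j).1], by linarith [(hK.support_subset hz j).2]⟩

theorem le_supNorm (hK : IsKernel K) (z : Fin d → ℝ) : K z ≤ supNorm K :=
  (le_abs_self _).trans (le_ciSup hK.bounded z)

theorem integrable (hK : IsKernel K) : Integrable K :=
  .of_integral_ne_zero (by rw [hK.integral_eq_one]; exact one_ne_zero)

theorem abs_mul_le (hK : IsKernel K) {y C : ℝ} {z : Fin d → ℝ} (hy : K z ≠ 0 → |y| ≤ C) :
    |y * K z| ≤ C * K z := by
  rw [abs_mul, abs_of_nonneg (hK.nonneg z)]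
  rcases eq_or_ne (K z) 0 with hz | hz
  · simp [hz]
  · exact mul_le_mul_of_nonneg_right (hy hz) (hK.nonneg z)

theorem integrable_mul (hK : IsKernel K) {φ : (Fin d → ℝ) → ℝ} (hφ : Measurable φ) {C : ℝ}
    (hC : ∀ z, K z ≠ 0 → |φ z| ≤ C) : Integrable fun z => φ z * K z :=
  (hK.integrable.const_mul C).mono' (hφ.mul hK.measurable).aestronglyMeasurable
    (ae_of_all _ fun z => hK.abs_mul_le (hC z))

theorem one_le_supNorm (hK : IsKernel K) : 1 ≤ supNorm K := by
  set S : Set (Fin d → ℝ) := Set.Icc (fun _ => -(1 / 2)) (fun _ => 1 / 2) with hS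
  have hvol : volume S = 1 := by
    rw [hS, Real.volume_Icc_pi]
    norm_num
  have hout (z : Fin d → ℝ) (hz : z ∉ S) : K z = 0 := by
    by_contra h
    exact hz ⟨fun j => (hK.support_subset h j).1, fun j => (hK.support_subset h j).2⟩
  calc (1 : ℝ) = ∫ z in S, K z := by
        rw [← hK.integral_eq_one, setIntegral_eq_integral_of_forall_compl_eq_zero hout]
    _ ≤ ∫ _ in S, supNorm K := setIntegral_mono hK.integrable.integrableOn
        (integrableOn_const (by simp [hvol])) hK.le_supNorm
    _ = supNorm K := by simp [Measure.real, hvol]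

theorem momentMatrix_apply (hK : IsKernel K) (p q : multiIdx d b) :
    momentMatrix b K p q = ∫ z, monomial p.1 z * monomial q.1 z * K z :=
  setIntegral_eq_integral_of_forall_compl_eq_zero fun z hz => by
    rw [not_not.1 fun h : K z ≠ 0 => hz (hK.support_subset h), mul_zero]

theorem dotProduct_momentMatrix_mulVec (hK : IsKernel K) (t : multiIdx d b → ℝ) :
    t ⬝ᵥ momentMatrix b K *ᵥ t = ∫ z, polyVal t z ^ 2 * K z := by
  have hint (p q : multiIdx d b) :
      Integrable fun z => t p * (t q * (monomial p.1 z * monomial q.1 z * K z)) :=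
    ((hK.integrable_mul (φ := fun z => monomial p.1 z * monomial q.1 z) (by fun_prop) (C := 1)
      fun z hz => by
        rw [abs_mul]
        exact mul_le_one₀ (abs_monomial_le_one _ (hK.abs_coord_le_one hz)) (abs_nonneg _)
          (abs_monomial_le_one _ (hK.abs_coord_le_one hz))).const_mul _).const_mul _
  calc t ⬝ᵥ momentMatrix b K *ᵥ t
      = ∑ p, ∑ q, ∫ z, t p * (t q * (monomial p.1 z * monomial q.1 z * K z)) := by
        simp only [dotProduct, Matrix.mulVec, Finset.mul_sum, hK.momentMatrix_apply,
          integral_const_mul, mul_comm]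
    _ = ∫ z, ∑ p, ∑ q, t p * (t q * (monomial p.1 z * monomial q.1 z * K z)) := by
        rw [integral_finsetSum _ fun p _ => integrable_finsetSum _ fun q _ => hint p q]
        exact Finset.sum_congr rfl fun p _ => (integral_finsetSum _ fun q _ => hint p q).symm
    _ = ∫ z, polyVal t z ^ 2 * K z := by
        refine integral_congr_ae (ae_of_all _ fun z => ?_)
        beta_reduce
        rw [polyVal, sq, Finset.sum_mul_sum]
        simp only [Finset.sum_mul]
        exact Finset.sum_congr rfl fun p _ => Finset.sum_congr rfl fun q _ => by ring

theorem integral_polyVal_sq_pos (hK : IsKernel K) {t : multiIdx d b → ℝ} (ht : t ≠ 0) :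
    0 < ∫ z, polyVal t z ^ 2 * K z := by
  have hnonneg (z : Fin d → ℝ) : 0 ≤ polyVal t z ^ 2 * K z :=
    mul_nonneg (sq_nonneg _) (hK.nonneg z)
  have hint : Integrable fun z => polyVal t z ^ 2 * K z :=
    hK.integrable_mul (by fun_prop) (C := (∑ p, |t p|) ^ 2) fun z hz => by
      rw [abs_pow]
      exact pow_le_pow_left₀ (abs_nonneg _) (abs_polyVal_le t (hK.abs_coord_le_one hz)) 2
  refine (integral_nonneg hnonneg).lt_of_ne fun h => ?_
  have hKzero : K =ᵐ[volume] 0 := by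
    filter_upwards [(integral_eq_zero_iff_of_nonneg hnonneg hint).1 h.symm,
      ae_polyVal_ne_zero ht] with z hz hne
    simpa [hne] using hz
  exact one_ne_zero (hK.integral_eq_one.symm.trans (integral_eq_zero_of_ae hKzero))

theorem posDef_momentMatrix (hK : IsKernel K) : (momentMatrix b K).PosDef := by
  refine .of_dotProduct_mulVec_pos ?_ fun t ht => ?_
  · ext p q
    simp [momentMatrix, mul_comm (monomial q.1 _)]
  · rw [star_trivial, hK.dotProduct_momentMatrix_mulVec]
    exact hK.integral_polyVal_sq_pos ht

end IsKernel

theorem sInf_spectrum_mul_sum_sq_le {ι : Type*} [Fintype ι] [DecidableEq ι]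
    {A : Matrix ι ι ℝ} (hA : A.IsHermitian) (t : ι → ℝ) :
    sInf (spectrum ℝ A) * ∑ i, t i ^ 2 ≤ t ⬝ᵥ A *ᵥ t := by
  set l := sInf (spectrum ℝ A)
  have hpsd : (A - algebraMap ℝ (Matrix ι ι ℝ) l).PosSemidef := by
    refine Matrix.posSemidef_iff_isHermitian_and_spectrum_nonneg.2
      ⟨hA.sub (IsSelfAdjoint.algebraMap _ (.all l)), ?_⟩
    rw [← spectrum.sub_singleton_eq]
    rintro _ ⟨x, hx, _, rfl, rfl⟩
    exact sub_nonneg.2 (csInf_le A.finite_real_spectrum.bddBelow hx)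
  have h := hpsd.dotProduct_mulVec_nonneg t
  rw [star_trivial, Matrix.sub_mulVec, dotProduct_sub, Algebra.algebraMap_eq_smul_one,
    Matrix.smul_mulVec, Matrix.one_mulVec, dotProduct_smul, smul_eq_mul] at h
  simpa only [dotProduct, sq, sub_nonneg] using h

section MinEigen

variable {d b : ℕ} {K : (Fin d → ℝ) → ℝ}

theorem IsKernel.minEigen_mul_le (hK : IsKernel K) (t : multiIdx d b → ℝ) :
    minEigen b K * ∑ p, t p ^ 2 ≤ ∫ z, polyVal t z ^ 2 * K z :=
  (sInf_spectrum_mul_sum_sq_le hK.posDef_momentMatrix.isHermitian t).trans_eq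
    (hK.dotProduct_momentMatrix_mulVec t)

theorem IsKernel.minEigen_pos (hK : IsKernel K) : 0 < minEigen b K := by
  have hA : (momentMatrix b K).PosDef := hK.posDef_momentMatrix
  have hmem : minEigen b K ∈ spectrum ℝ (momentMatrix b K) :=
    Set.Nonempty.csInf_mem ⟨_, hA.isHermitian.eigenvalues_mem_spectrum_real (zeroIdx d b)⟩
      Matrix.finite_real_spectrum
  rw [hA.isHermitian.spectrum_real_eq_range_eigenvalues] at hmem
  obtain ⟨i, hi⟩ := hmem
  exact hi ▸ hA.eigenvalues_pos i

end MinEigen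

/-! ### The averaged score -/

/-- A bounded Lipschitz score, such as the derivative of a contrast function; `R` bounds it. -/
structure IsBoundedScore (ψ : ℝ → ℝ) (R : ℝ) : Prop where
  lipschitz : LipschitzWith 1 ψ
  abs_le : ∀ z, |ψ z| ≤ R

/-- The averaged score `w ↦ ∫ ψ(z + w) ν(dz)` of the noise law `ν`. -/
def meanScore (ψ : ℝ → ℝ) (ν : Measure ℝ) (w : ℝ) : ℝ := ∫ z, ψ (z + w) ∂ν

/-- The averaged score grows at least linearly, with slope `κ`, on `[-w₀, w₀]`. -/
def HasScoreSlope (ψ : ℝ → ℝ) (ν : Measure ℝ) (κ w₀ : ℝ) : Prop :=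
  ∀ w, |w| ≤ w₀ → κ * w ^ 2 ≤ w * meanScore ψ ν w

section Score

variable {ψ : ℝ → ℝ} {R : ℝ} {ν : Measure ℝ} [IsProbabilityMeasure ν]

namespace IsBoundedScore

theorem nonneg (hψ : IsBoundedScore ψ R) : 0 ≤ R := (abs_nonneg _).trans (hψ.abs_le 0)

theorem measurable (hψ : IsBoundedScore ψ R) : Measurable ψ :=
  hψ.lipschitz.continuous.measurable

theorem abs_sub_le (hψ : IsBoundedScore ψ R) (u v : ℝ) : |ψ u - ψ v| ≤ |u - v| := by
  simpa [Real.dist_eq] using hψ.lipschitz.dist_le_mul u v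

theorem integrable_add_const (hψ : IsBoundedScore ψ R) (w : ℝ) :
    Integrable (fun z => ψ (z + w)) ν :=
  .of_bound (hψ.measurable.comp (measurable_add_const w)).aestronglyMeasurable R
    (ae_of_all _ fun _ => hψ.abs_le _)

theorem abs_meanScore_sub_le (hψ : IsBoundedScore ψ R) (u v : ℝ) :
    |meanScore ψ ν u - meanScore ψ ν v| ≤ |u - v| := by
  rw [meanScore, meanScore,
    ← integral_sub (hψ.integrable_add_const u) (hψ.integrable_add_const v)]
  have hbound (z : ℝ) : ‖ψ (z + u) - ψ (z + v)‖ ≤ |u - v| := by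
    simpa using hψ.abs_sub_le (z + u) (z + v)
  simpa using norm_integral_le_of_norm_le_const (μ := ν) (ae_of_all _ hbound)

/-- `v` is the approximation error and `-q` the shift caused by a deviation `q` of the fit. -/
theorem meanScore_mul_le (hψ : IsBoundedScore ψ R) {κ w₀ β v q : ℝ}
    (hslope : HasScoreSlope ψ ν κ w₀) (hv : |v| ≤ β) (hq : |q| ≤ w₀) :
    meanScore ψ ν (v - q) * q ≤ β * |q| - κ * q ^ 2 := by
  have herr : (meanScore ψ ν (v - q) - meanScore ψ ν (-q)) * q ≤ β * |q| := by
    refine (le_abs_self _).trans ?_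
    rw [abs_mul]
    gcongr
    exact (hψ.abs_meanScore_sub_le _ _).trans (by simpa using hv)
  have hmain := hslope (-q) (by rwa [abs_neg])
  linarith

end IsBoundedScore

theorem mul_integral_deriv_add_mul (hψ : LipschitzWith 1 ψ) (z w : ℝ) :
    w * ∫ s in (0 : ℝ)..1, deriv ψ (z + w * s) = ψ (z + w) - ψ z := by
  rw [intervalIntegral.mul_integral_comp_add_mul, mul_zero, add_zero, mul_one]
  exact (hψ.lipschitzOnWith (s := Set.uIcc z (z + w))
    ).absolutelyContinuousOnInterval.integral_deriv_eq_sub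

theorem integrable_deriv_add_mul (hψ : LipschitzWith 1 ψ) (w : ℝ) :
    Integrable (fun y : ℝ × ℝ => deriv ψ (y.2 + w * y.1))
      ((volume.restrict (Set.uIoc 0 1)).prod ν) := by
  have _ : IsFiniteMeasure (volume.restrict (Set.uIoc (0 : ℝ) 1)) := ⟨by simp⟩
  exact .of_bound ((measurable_deriv ψ).comp (by fun_prop)).aestronglyMeasurable 1
    (ae_of_all _ fun _ => by simpa using norm_deriv_le_of_lipschitz hψ)

theorem meanScore_sub_meanScore_zero (hψ : IsBoundedScore ψ R) (w : ℝ) :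
    meanScore ψ ν w - meanScore ψ ν 0 =
      w * ∫ s in (0 : ℝ)..1, ∫ z, deriv ψ (z + w * s) ∂ν := by
  rw [intervalIntegral_integral_swap (integrable_deriv_add_mul hψ.lipschitz w),
    ← integral_const_mul, meanScore, meanScore,
    ← integral_sub (hψ.integrable_add_const w) (hψ.integrable_add_const 0)]
  simp only [mul_integral_deriv_add_mul hψ.lipschitz, add_zero]

omit [IsProbabilityMeasure ν] in
theorem meanScore_zero [ν.IsNegInvariant] (hodd : ψ.Odd) : meanScore ψ ν 0 = 0 := by
  have h : meanScore ψ ν 0 = -meanScore ψ ν 0 := by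
    simp only [meanScore, add_zero]
    rw [← integral_neg, ← integral_neg_eq_self]
    simp only [hodd _]
  linarith

theorem half_le_integral_deriv (hψ : LipschitzWith 1 ψ) {L α c v w₀ : ℝ} (hL : 0 ≤ L) (hα : 0 ≤ α)
    (hholder : ∀ u v, ∫ z, |deriv ψ (z + u) - deriv ψ (z + v)| ∂ν ≤ L * |u - v| ^ α)
    (hc : c ≤ ∫ z, deriv ψ z ∂ν) (hw₀ : L * w₀ ^ α ≤ c / 2) (hv : |v| ≤ w₀) :
    c / 2 ≤ ∫ z, deriv ψ (z + v) ∂ν := by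
  have hint (u : ℝ) : Integrable (fun z => deriv ψ (z + u)) ν :=
    .of_bound ((measurable_deriv ψ).comp (measurable_add_const u)).aestronglyMeasurable 1
      (ae_of_all _ fun _ => by simpa using norm_deriv_le_of_lipschitz hψ)
  have hdiff : ∫ z, deriv ψ (z + 0) ∂ν - ∫ z, deriv ψ (z + v) ∂ν ≤ c / 2 :=
    calc ∫ z, deriv ψ (z + 0) ∂ν - ∫ z, deriv ψ (z + v) ∂ν
        = ∫ z, (deriv ψ (z + 0) - deriv ψ (z + v)) ∂ν := (integral_sub (hint 0) (hint v)).symm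
      _ ≤ ∫ z, |deriv ψ (z + 0) - deriv ψ (z + v)| ∂ν :=
        (le_abs_self _).trans abs_integral_le_integral_abs
      _ ≤ L * |v| ^ α := by simpa using hholder 0 v
      _ ≤ c / 2 := le_trans (by gcongr) hw₀
  simp only [add_zero] at hdiff
  linarith

theorem hasScoreSlope_of_holder [ν.IsNegInvariant] (hψ : IsBoundedScore ψ R) (hodd : ψ.Odd)
    {L α c w₀ : ℝ} (hL : 0 ≤ L) (hα : 0 ≤ α)
    (hholder : ∀ u v, ∫ z, |deriv ψ (z + u) - deriv ψ (z + v)| ∂ν ≤ L * |u - v| ^ α)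
    (hc : c ≤ ∫ z, deriv ψ z ∂ν) (hw₀ : L * w₀ ^ α ≤ c / 2) :
    HasScoreSlope ψ ν (c / 2) w₀ := by
  intro w hw
  have hlow : c / 2 ≤ ∫ s in (0 : ℝ)..1, ∫ z, deriv ψ (z + w * s) ∂ν := by
    calc c / 2 = ∫ _ in (0 : ℝ)..1, c / 2 := by simp
      _ ≤ _ := by
        refine intervalIntegral.integral_mono_on zero_le_one (by simp)
          (intervalIntegrable_iff.2
            (integrable_deriv_add_mul hψ.lipschitz w).integral_prod_left) fun s hs => ?_
        refine half_le_integral_deriv hψ.lipschitz hL hα hholder hc hw₀ (le_trans ?_ hw)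
        rw [abs_mul, abs_of_nonneg hs.1]
        exact mul_le_of_le_one_right (abs_nonneg _) hs.2
  have hmean := meanScore_sub_meanScore_zero (ν := ν) hψ w
  rw [meanScore_zero hodd, sub_zero] at hmean
  calc c / 2 * w ^ 2 ≤ (∫ s in (0 : ℝ)..1, ∫ z, deriv ψ (z + w * s) ∂ν) * w ^ 2 := by gcongr
    _ = w * meanScore ψ ν w := by rw [hmean]; ring

end Score

/-! ### The rescaled design -/

/-- The change of variables `x ↦ (x - x₀) / h` to the kernel window. -/
def rescale {d : ℕ} (x₀ : Fin d → ℝ) (h : ℝ) (x : Fin d → ℝ) : Fin d → ℝ :=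
  fun j => (x j - x₀ j) / h

/-- `K` is a kernel, and its window around `x₀` with bandwidth `h > 0` lies in the unit cube. -/
structure IsWindow {d : ℕ} (K : (Fin d → ℝ) → ℝ) (x₀ : Fin d → ℝ) (h : ℝ) : Prop where
  isKernel : IsKernel K
  pos : 0 < h
  mem_unitCube : ∀ z, K z ≠ 0 → x₀ + h • z ∈ unitCube d

/-- The law of an observation `(X, ξ)`: `X` is uniform on the unit cube, and `ξ` has law `ν` and is
independent of `X`. -/
def obsLaw (d : ℕ) (ν : Measure ℝ) : Measure ((Fin d → ℝ) × ℝ) :=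
  (volume.restrict (unitCube d)).prod ν

/-- Measurable functions of an observation that are dominated by a multiple of the rescaled kernel.
Their variance under the design is of order `h ^ d`. -/
structure IsKernelDominated {d : ℕ} (K : (Fin d → ℝ) → ℝ) (x₀ : Fin d → ℝ) (h A : ℝ)
    (Φ : (Fin d → ℝ) × ℝ → ℝ) : Prop where
  measurable : Measurable Φ
  abs_le : ∀ y, |Φ y| ≤ A * K (rescale x₀ h y.1)

instance isProbabilityMeasure_restrict_unitCube (d : ℕ) :
    IsProbabilityMeasure (volume.restrict (unitCube d)) :=
  ⟨by simp [unitCube, Real.volume_Icc_pi]⟩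

instance isProbabilityMeasure_obsLaw (d : ℕ) (ν : Measure ℝ) [IsProbabilityMeasure ν] :
    IsProbabilityMeasure (obsLaw d ν) :=
  inferInstanceAs (IsProbabilityMeasure ((volume.restrict (unitCube d)).prod ν))

section Design

variable {d b : ℕ} {x₀ x : Fin d → ℝ} {h : ℝ}

@[fun_prop]
theorem measurable_rescale (x₀ : Fin d → ℝ) (h : ℝ) : Measurable (rescale x₀ h) := by
  unfold rescale
  fun_prop

theorem rescale_eq_smul (x₀ : Fin d → ℝ) (h : ℝ) (x : Fin d → ℝ) :
    rescale x₀ h x = h⁻¹ • (x - x₀) := by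
  ext j
  simp [rescale, div_eq_inv_mul]

theorem measurableSet_nbhd (x₀ : Fin d → ℝ) (h : ℝ) : MeasurableSet (nbhd x₀ h) := by
  refine MeasurableSet.inter ?_ measurableSet_Icc
  simp only [Set.ofPred_forall]
  exact .iInter fun j => measurable_pi_apply j measurableSet_Icc

theorem localPoly_of_mem (t : multiIdx d b → ℝ) (hx : x ∈ nbhd x₀ h) :
    localPoly x₀ h t x = polyVal t (rescale x₀ h x) :=
  Set.indicator_of_mem hx _

theorem localPoly_sub_of_mem (s t : multiIdx d b → ℝ) (hx : x ∈ nbhd x₀ h) :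
    localPoly x₀ h s x - localPoly x₀ h t x = polyVal (s - t) (rescale x₀ h x) := by
  rw [localPoly_of_mem s hx, localPoly_of_mem t hx, polyVal_sub]

@[fun_prop]
theorem measurable_localPoly (x₀ : Fin d → ℝ) (h : ℝ) (t : multiIdx d b → ℝ) :
    Measurable (localPoly x₀ h t) :=
  ((measurable_polyVal t).comp (measurable_rescale x₀ h)).indicator (measurableSet_nbhd x₀ h)

variable {K : (Fin d → ℝ) → ℝ} {ν : Measure ℝ} [IsProbabilityMeasure ν]

namespace IsWindow

theorem mem_nbhd (hw : IsWindow K x₀ h) (hx : K (rescale x₀ h x) ≠ 0) : x ∈ nbhd x₀ h := by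
  have hcube : x₀ + h • rescale x₀ h x = x := by
    rw [rescale_eq_smul, smul_inv_smul₀ hw.pos.ne', add_sub_cancel]
  refine ⟨fun j => ?_, hcube ▸ hw.mem_unitCube _ hx⟩
  have hj := hw.isKernel.support_subset hx j
  simp only [rescale, Set.mem_Icc, le_div_iff₀ hw.pos, div_le_iff₀ hw.pos] at hj ⊢
  constructor <;> linarith [hj.1, hj.2]

theorem setIntegral_comp_rescale (hw : IsWindow K x₀ h) (φ : (Fin d → ℝ) → ℝ) :
    ∫ x in unitCube d, φ (rescale x₀ h x) * K (rescale x₀ h x) = h ^ d * ∫ z, φ z * K z := by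
  rw [setIntegral_eq_integral_of_forall_compl_eq_zero fun x hx => ?_]
  · simp_rw [rescale_eq_smul]
    rw [integral_sub_right_eq_self (fun x => φ (h⁻¹ • x) * K (h⁻¹ • x)) x₀,
      Measure.integral_comp_inv_smul volume (fun x => φ x * K x) h]
    simp [abs_of_pos hw.pos]
  · rw [not_ne_iff.1 fun hz => hx (hw.mem_nbhd hz).2, mul_zero]

theorem isKernelDominated_kernel (hw : IsWindow K x₀ h) :
    IsKernelDominated K x₀ h 1 fun y => K (rescale x₀ h y.1) where
  measurable := hw.isKernel.measurable.comp (by fun_prop)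
  abs_le y := by rw [one_mul, abs_of_nonneg (hw.isKernel.nonneg _)]

theorem integral_kernel_obsLaw (hw : IsWindow K x₀ h) :
    ∫ y, K (rescale x₀ h y.1) ∂obsLaw d ν = h ^ d := by
  have hdesign := hw.setIntegral_comp_rescale 1
  simp only [Pi.one_apply, one_mul, hw.isKernel.integral_eq_one, mul_one] at hdesign
  rw [obsLaw, integral_fun_fst fun x => K (rescale x₀ h x), hdesign]
  simp

end IsWindow

namespace IsKernelDominated

variable {A B : ℝ} {Φ Ψ : (Fin d → ℝ) × ℝ → ℝ}

theorem abs_le_mul_supNorm (hw : IsWindow K x₀ h) (hΦ : IsKernelDominated K x₀ h A Φ)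
    (hA : 0 ≤ A) (y : (Fin d → ℝ) × ℝ) : |Φ y| ≤ A * supNorm K :=
  (hΦ.abs_le y).trans (mul_le_mul_of_nonneg_left (hw.isKernel.le_supNorm _) hA)

theorem mono (hw : IsWindow K x₀ h) (hΦ : IsKernelDominated K x₀ h A Φ) (hAB : A ≤ B) :
    IsKernelDominated K x₀ h B Φ where
  measurable := hΦ.measurable
  abs_le y := (hΦ.abs_le y).trans (mul_le_mul_of_nonneg_right hAB (hw.isKernel.nonneg _))

theorem integrable (hw : IsWindow K x₀ h) (hΦ : IsKernelDominated K x₀ h A Φ) :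
    Integrable Φ (obsLaw d ν) := by
  have hK : Integrable (fun y => K (rescale x₀ h y.1)) (obsLaw d ν) :=
    .of_integral_ne_zero (by rw [hw.integral_kernel_obsLaw]; exact (pow_pos hw.pos d).ne')
  exact (hK.const_mul A).mono' hΦ.measurable.aestronglyMeasurable (ae_of_all _ hΦ.abs_le)

theorem abs_integral_le (hw : IsWindow K x₀ h) (hΦ : IsKernelDominated K x₀ h A Φ) :
    |∫ y, Φ y ∂obsLaw d ν| ≤ A * h ^ d := by
  rw [← hw.integral_kernel_obsLaw (ν := ν), ← integral_const_mul]
  exact norm_integral_le_of_norm_le (f := Φ)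
    ((hw.isKernelDominated_kernel.integrable hw).const_mul A) (ae_of_all _ hΦ.abs_le)

theorem integral_sq_le (hw : IsWindow K x₀ h) (hΦ : IsKernelDominated K x₀ h A Φ) :
    ∫ y, Φ y ^ 2 ∂obsLaw d ν ≤ A ^ 2 * supNorm K * h ^ d := by
  have hsq (y : (Fin d → ℝ) × ℝ) : Φ y ^ 2 ≤ A ^ 2 * supNorm K * K (rescale x₀ h y.1) := by
    have hK0 := hw.isKernel.nonneg (rescale x₀ h y.1)
    calc Φ y ^ 2 = |Φ y| ^ 2 := (sq_abs _).symm
      _ ≤ (A * K (rescale x₀ h y.1)) ^ 2 := by gcongr; exact hΦ.abs_le y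
      _ = A ^ 2 * (K (rescale x₀ h y.1) * K (rescale x₀ h y.1)) := by ring
      _ ≤ A ^ 2 * (supNorm K * K (rescale x₀ h y.1)) := by
        gcongr
        exact hw.isKernel.le_supNorm _
      _ = _ := by ring
  rw [← hw.integral_kernel_obsLaw (ν := ν), ← integral_const_mul]
  exact integral_mono_of_nonneg (ae_of_all _ fun _ => sq_nonneg _)
    ((hw.isKernelDominated_kernel.integrable hw).const_mul _) (ae_of_all _ hsq)

end IsKernelDominated

end Design

/-! ### The score at a parameter -/

/-- The contribution of an observation `y = (x, ξ)` with response `f x + ξ` to the component `p` of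
the score, which is minus the gradient of the criterion, at the parameter `t`. -/
def scoreTerm {d b : ℕ} (ψ : ℝ → ℝ) (K : (Fin d → ℝ) → ℝ) (x₀ : Fin d → ℝ) (h : ℝ)
    (f : (Fin d → ℝ) → ℝ) (t : multiIdx d b → ℝ) (p : multiIdx d b) (y : (Fin d → ℝ) × ℝ) : ℝ :=
  ψ (f y.1 + y.2 - localPoly x₀ h t y.1) * monomial p.1 (rescale x₀ h y.1) *
    K (rescale x₀ h y.1)

section ScoreTerm

variable {d b : ℕ} {ψ : ℝ → ℝ} {R : ℝ} {K : (Fin d → ℝ) → ℝ} {x₀ : Fin d → ℝ} {h : ℝ}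
  {f : (Fin d → ℝ) → ℝ}

theorem measurable_scoreTerm (hK : Measurable K) (hψ : Measurable ψ) (hf : Measurable f)
    (t : multiIdx d b → ℝ) (p : multiIdx d b) : Measurable (scoreTerm ψ K x₀ h f t p) := by
  unfold scoreTerm
  fun_prop

theorem isKernelDominated_scoreTerm (hK : IsKernel K) (hψ : IsBoundedScore ψ R)
    (hf : Measurable f) (t : multiIdx d b → ℝ) (p : multiIdx d b) :
    IsKernelDominated K x₀ h R (scoreTerm ψ K x₀ h f t p) where
  measurable := measurable_scoreTerm hK.measurable hψ.measurable hf t p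
  abs_le y := hK.abs_mul_le fun hz => by
    rw [abs_mul]
    exact (mul_le_of_le_one_right (abs_nonneg _)
      (abs_monomial_le_one _ (hK.abs_coord_le_one hz))).trans (hψ.abs_le _)

theorem isKernelDominated_scoreTerm_sub (hw : IsWindow K x₀ h) (hψ : IsBoundedScore ψ R)
    (hf : Measurable f) (s t : multiIdx d b → ℝ) (p : multiIdx d b) :
    IsKernelDominated K x₀ h (∑ q, |s q - t q|)
      fun y => scoreTerm ψ K x₀ h f s p y - scoreTerm ψ K x₀ h f t p y where
  measurable := (measurable_scoreTerm hw.isKernel.measurable hψ.measurable hf s p).sub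
    (measurable_scoreTerm hw.isKernel.measurable hψ.measurable hf t p)
  abs_le y := by
    rw [scoreTerm, scoreTerm, ← sub_mul, ← sub_mul]
    refine hw.isKernel.abs_mul_le fun hz => ?_
    have hcoord := hw.isKernel.abs_coord_le_one hz
    rw [abs_mul]
    refine (mul_le_of_le_one_right (abs_nonneg _) (abs_monomial_le_one _ hcoord)).trans ?_
    refine (hψ.abs_sub_le _ _).trans ?_
    rw [sub_sub_sub_cancel_left, abs_sub_comm, localPoly_sub_of_mem s t (hw.mem_nbhd hz)]
    exact abs_polyVal_le (s - t) hcoord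

theorem sum_mul_scoreTerm (s t : multiIdx d b → ℝ) (y : (Fin d → ℝ) × ℝ) :
    ∑ p, s p * scoreTerm ψ K x₀ h f t p y =
      ψ (f y.1 + y.2 - localPoly x₀ h t y.1) * polyVal s (rescale x₀ h y.1) *
        K (rescale x₀ h y.1) := by
  rw [polyVal, Finset.mul_sum, Finset.sum_mul]
  exact Finset.sum_congr rfl fun p _ => by rw [scoreTerm]; ring

variable {ν : Measure ℝ} [IsProbabilityMeasure ν] {κ w₀ β : ℝ} {θ s : multiIdx d b → ℝ}

theorem integral_sum_mul_scoreTerm_noise_le (hw : IsWindow K x₀ h) (hψ : IsBoundedScore ψ R)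
    (hslope : HasScoreSlope ψ ν κ w₀) (hβ : ∀ x ∈ nbhd x₀ h, |f x - localPoly x₀ h θ x| ≤ β)
    (hs : ∑ p, |s p| ≤ w₀) (x : Fin d → ℝ) :
    ∫ z, ∑ p, s p * scoreTerm ψ K x₀ h f (θ + s) p (x, z) ∂ν ≤
      (β * ∑ p, |s p| - κ * polyVal s (rescale x₀ h x) ^ 2) * K (rescale x₀ h x) := by
  simp_rw [sum_mul_scoreTerm, integral_mul_const]
  rcases eq_or_ne (K (rescale x₀ h x)) 0 with hz | hz
  · simp [hz]
  · have hx := hw.mem_nbhd hz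
    set q := polyVal s (rescale x₀ h x) with hq
    have hqs : |q| ≤ ∑ p, |s p| := abs_polyVal_le s (hw.isKernel.abs_coord_le_one hz)
    have hshift : localPoly x₀ h (θ + s) x = localPoly x₀ h θ x + q := by
      rw [hq, ← sub_eq_iff_eq_add', localPoly_sub_of_mem _ _ hx, add_sub_cancel_left]
    have hmean : ∫ z, ψ (f x + z - localPoly x₀ h (θ + s) x) ∂ν =
        meanScore ψ ν (f x - localPoly x₀ h θ x - q) := by
      rw [meanScore, hshift]
      congr! 3
      ring
    have hβ0 : 0 ≤ β := (abs_nonneg _).trans (hβ x hx)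
    rw [hmean]
    refine mul_le_mul_of_nonneg_right ?_ (hw.isKernel.nonneg _)
    exact (hψ.meanScore_mul_le hslope (hβ x hx) (hqs.trans hs)).trans (by gcongr)

theorem integral_sum_mul_scoreTerm_le (hw : IsWindow K x₀ h) (hψ : IsBoundedScore ψ R)
    (hf : Measurable f) (hκ : 0 ≤ κ) (hslope : HasScoreSlope ψ ν κ w₀)
    (hβ : ∀ x ∈ nbhd x₀ h, |f x - localPoly x₀ h θ x| ≤ β) (hs : ∑ p, |s p| ≤ w₀) :
    ∫ y, ∑ p, s p * scoreTerm ψ K x₀ h f (θ + s) p y ∂obsLaw d ν ≤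
      h ^ d * (β * ∑ p, |s p| - κ * (minEigen b K * ∑ p, s p ^ 2)) := by
  have hint : Integrable (fun y => ∑ p, s p * scoreTerm ψ K x₀ h f (θ + s) p y) (obsLaw d ν) :=
    integrable_finsetSum _ fun p _ =>
      ((isKernelDominated_scoreTerm hw.isKernel hψ hf _ p).integrable hw).const_mul _
  have hsq : Integrable fun z => polyVal s z ^ 2 * K z :=
    hw.isKernel.integrable_mul (by fun_prop) (C := (∑ p, |s p|) ^ 2) fun z hz => by
      rw [abs_pow]
      gcongr
      exact abs_polyVal_le s (hw.isKernel.abs_coord_le_one hz)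
  have hexp (z : Fin d → ℝ) : (β * ∑ p, |s p| - κ * polyVal s z ^ 2) * K z =
      β * (∑ p, |s p|) * K z - κ * (polyVal s z ^ 2 * K z) := by ring
  have hmain : Integrable fun z => (β * ∑ p, |s p| - κ * polyVal s z ^ 2) * K z := by
    simp_rw [hexp]
    exact (hw.isKernel.integrable.const_mul _).sub (hsq.const_mul _)
  calc ∫ y, ∑ p, s p * scoreTerm ψ K x₀ h f (θ + s) p y ∂obsLaw d ν
      = ∫ x in unitCube d, ∫ z, ∑ p, s p * scoreTerm ψ K x₀ h f (θ + s) p (x, z) ∂ν :=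
        integral_prod _ hint
    _ ≤ ∫ x in unitCube d,
          (β * ∑ p, |s p| - κ * polyVal s (rescale x₀ h x) ^ 2) * K (rescale x₀ h x) := by
        refine integral_mono hint.integral_prod_left (Integrable.integrableOn ?_)
          (integral_sum_mul_scoreTerm_noise_le hw hψ hslope hβ hs)
        simp_rw [rescale_eq_smul]
        exact (hmain.comp_smul (inv_ne_zero hw.pos.ne')).comp_sub_right x₀
    _ = h ^ d * (β * ∑ p, |s p| - κ * ∫ z, polyVal s z ^ 2 * K z) := by
        rw [hw.setIntegral_comp_rescale fun z => β * ∑ p, |s p| - κ * polyVal s z ^ 2]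
        simp_rw [hexp]
        rw [integral_sub (hw.isKernel.integrable.const_mul _) (hsq.const_mul _),
          integral_const_mul, integral_const_mul, hw.isKernel.integral_eq_one, mul_one]
    _ ≤ _ := by
        gcongr
        · exact pow_nonneg hw.pos.le d
        · exact hw.isKernel.minEigen_mul_le s

end ScoreTerm

/-! ### The first-order condition -/

theorem hasDerivAt_nonpos_of_forall_le {φ : ℝ → ℝ} {φ' : ℝ} (hφ : HasDerivAt φ φ' 1)
    (hmin : ∀ σ ∈ Set.Icc (0 : ℝ) 1, φ 1 ≤ φ σ) : φ' ≤ 0 := by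
  have hmin' : IsLocalMinOn φ (Set.Icc 0 1) 1 :=
    eventually_nhdsWithin_of_forall hmin
  have hcone : (0 : ℝ) - 1 ∈ posTangentConeAt (Set.Icc (0 : ℝ) 1) 1 :=
    sub_mem_posTangentConeAt_of_segment_subset
      ((convex_Icc 0 1).segment_subset (by simp) (by simp))
  simpa using hmin'.hasFDerivWithinAt_nonneg hφ.hasFDerivAt.hasFDerivWithinAt hcone

theorem sum_deriv_mul_nonneg_of_forall_le {ι : Type*} [Fintype ι] {ρ : ℝ → ℝ}
    (hconv : ConvexOn ℝ Set.univ ρ) (hdiff : Differentiable ℝ ρ) {a w k : ι → ℝ}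
    (hk : ∀ i, 0 ≤ k i)
    (hmin : ∀ σ ∈ Set.Icc (0 : ℝ) 1, ∑ i, ρ (a i - 1 * w i) * k i ≤ ∑ i, ρ (a i - σ * w i) * k i)
    {τ : ℝ} (hτ : τ ≤ 1) : 0 ≤ ∑ i, deriv ρ (a i - τ * w i) * w i * k i := by
  have hderiv : HasDerivAt (fun σ => ∑ i, ρ (a i - σ * w i) * k i)
      (∑ i, deriv ρ (a i - 1 * w i) * (-w i) * k i) 1 := by
    refine HasDerivAt.fun_sum fun i _ => HasDerivAt.mul_const ?_ _
    have hline : HasDerivAt (fun σ => a i - σ * w i) (-w i) 1 := by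
      simpa using ((hasDerivAt_id (1 : ℝ)).mul_const (w i)).const_sub (a i)
    exact (hdiff _).hasDerivAt.comp _ hline
  have hend : 0 ≤ ∑ i, deriv ρ (a i - 1 * w i) * w i * k i := by
    have hle := hasDerivAt_nonpos_of_forall_le hderiv hmin
    simpa only [mul_neg, neg_mul, Finset.sum_neg_distrib, neg_nonpos] using hle
  refine hend.trans (Finset.sum_le_sum fun i _ => mul_le_mul_of_nonneg_right ?_ (hk i))
  have hmono : Monotone (deriv ρ) :=
    monotoneOn_univ.1 (hconv.monotoneOn_deriv fun x _ => hdiff x)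
  rcases le_total 0 (w i) with hw | hw
  · exact mul_le_mul_of_nonneg_right (hmono (by gcongr)) hw
  · exact mul_le_mul_of_nonpos_right
      (hmono (sub_le_sub_left (mul_le_mul_of_nonpos_right hτ hw) _)) hw

section FirstOrder

variable {d b : ℕ} {M : ℝ}

theorem convex_paramSet : Convex ℝ (paramSet d b M) := by
  intro s hs t ht a a' ha ha' haa'
  calc ∑ p, |(a • s + a' • t) p| ≤ ∑ p, (a * |s p| + a' * |t p|) := by
        refine Finset.sum_le_sum fun p _ => (abs_add_le _ _).trans_eq ?_
        simp [abs_mul, abs_of_nonneg ha, abs_of_nonneg ha']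
    _ = a * ∑ p, |s p| + a' * ∑ p, |t p| := by
        rw [Finset.sum_add_distrib, Finset.mul_sum, Finset.mul_sum]
    _ ≤ a * M + a' * M := by gcongr <;> assumption
    _ = M := by rw [← add_mul, haa', one_mul]

theorem localPoly_add_smul (x₀ : Fin d → ℝ) (h : ℝ) (θ v : multiIdx d b → ℝ) (τ : ℝ)
    (x : Fin d → ℝ) :
    localPoly x₀ h (θ + τ • v) x = localPoly x₀ h θ x + τ * localPoly x₀ h v x := by
  by_cases hx : x ∈ nbhd x₀ h
  · simp only [localPoly_of_mem _ hx, polyVal, Finset.mul_sum, ← Finset.sum_add_distrib,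
      Pi.add_apply, Pi.smul_apply, smul_eq_mul]
    exact Finset.sum_congr rfl fun p _ => by ring
  · simp [localPoly, hx]

/-- By convexity, the criterion decreases along the segment from `θ` to its minimizer. -/
theorem sum_scoreTerm_nonneg {n : ℕ} (hn : 0 < n) {ρ : ℝ → ℝ} (hconv : ConvexOn ℝ Set.univ ρ)
    (hdiff : Differentiable ℝ ρ) {K : (Fin d → ℝ) → ℝ} {x₀ : Fin d → ℝ} {h : ℝ}
    (hw : IsWindow K x₀ h) {f : (Fin d → ℝ) → ℝ} {x : Fin n → Fin d → ℝ} {e : Fin n → ℝ}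
    {θ t : multiIdx d b → ℝ} (hθ : θ ∈ paramSet d b M)
    (ht : IsLocalMEstimate ρ K M x₀ h x (fun i => f (x i) + e i) t)
    {τ : ℝ} (hτ0 : 0 ≤ τ) (hτ1 : τ ≤ 1) :
    0 ≤ ∑ i, ∑ p, (τ • (t - θ)) p *
      scoreTerm (deriv ρ) K x₀ h f (θ + τ • (t - θ)) p (x i, e i) := by
  have hmin (σ : ℝ) (hσ : σ ∈ Set.Icc (0 : ℝ) 1) :
      ∑ i, ρ (f (x i) + e i - localPoly x₀ h θ (x i) - 1 * localPoly x₀ h (t - θ) (x i)) *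
          K (rescale x₀ h (x i)) ≤
        ∑ i, ρ (f (x i) + e i - localPoly x₀ h θ (x i) - σ * localPoly x₀ h (t - θ) (x i)) *
          K (rescale x₀ h (x i)) := by
    have hle := ht.2 _ (convex_paramSet.add_smul_sub_mem hθ ht.1 hσ)
    have hpos : 0 < 1 / ((n : ℝ) * h ^ d) := by
      have := hw.pos
      positivity
    rw [criterion, criterion, mul_le_mul_iff_right₀ hpos] at hle
    simp only [sub_sub, ← localPoly_add_smul, one_smul, add_sub_cancel]
    exact hle
  refine (mul_nonneg hτ0 (sum_deriv_mul_nonneg_of_forall_le hconv hdiff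
    (fun i => hw.isKernel.nonneg _) hmin hτ1)).trans_eq ?_
  rw [Finset.mul_sum]
  refine Finset.sum_congr rfl fun i _ => ?_
  rw [sum_mul_scoreTerm, localPoly_add_smul, ← sub_sub]
  rcases eq_or_ne (K (rescale x₀ h (x i))) 0 with hz | hz
  · simp [hz]
  · have hpoly : polyVal (τ • (t - θ)) (rescale x₀ h (x i)) =
        τ * localPoly x₀ h (t - θ) (x i) := by
      rw [← localPoly_of_mem _ (hw.mem_nbhd hz)]
      simpa [localPoly] using localPoly_add_smul x₀ h 0 (t - θ) τ (x i)
    rw [hpoly]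
    ring

end FirstOrder

/-! ### Deviations of the score -/

/-- The observations `Z i = (X i, ξ i)` are independent, with laws `obsLaw d (ν i)`. -/
structure IsSample {Ω : Type*} [MeasurableSpace Ω] (P : Measure Ω) {d n : ℕ}
    (ν : Fin n → Measure ℝ) (Z : Fin n → Ω → (Fin d → ℝ) × ℝ) : Prop where
  measurable : ∀ i, Measurable (Z i)
  law : ∀ i, P.map (Z i) = obsLaw d (ν i)
  indep : iIndepFun Z P

/-- The centred sum of `Φ` over the sample. -/
def deviation {Ω : Type*} {d n : ℕ} (ν : Fin n → Measure ℝ) (Z : Fin n → Ω → (Fin d → ℝ) × ℝ)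
    (Φ : (Fin d → ℝ) × ℝ → ℝ) (ω : Ω) : ℝ :=
  ∑ i, (Φ (Z i ω) - ∫ y, Φ y ∂obsLaw d (ν i))

/-- The exponent in Bernstein's inequality for a deviation of size `q * u`, where `q ^ 2` is the
effective sample size and the summands are dominated by `A` times a kernel bounded by `κ`. -/
def bernsteinExponent (κ q A u : ℝ) : ℝ :=
  u ^ 2 / (2 * (A ^ 2 * κ + 2 * A * κ * u / (3 * q)))

section Deviation

variable {Ω : Type*} {d n : ℕ} {ν : Fin n → Measure ℝ} [∀ i, IsProbabilityMeasure (ν i)]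
  {Z : Fin n → Ω → (Fin d → ℝ) × ℝ} {K : (Fin d → ℝ) → ℝ} {x₀ : Fin d → ℝ} {h A B : ℝ}
  {Φ Ψ : (Fin d → ℝ) × ℝ → ℝ}

theorem deviation_sub (hw : IsWindow K x₀ h) (hΦ : IsKernelDominated K x₀ h A Φ)
    (hΨ : IsKernelDominated K x₀ h B Ψ) (ω : Ω) :
    deviation ν Z (fun y => Φ y - Ψ y) ω = deviation ν Z Φ ω - deviation ν Z Ψ ω := by
  simp only [deviation, integral_sub (hΦ.integrable hw) (hΨ.integrable hw),
    ← Finset.sum_sub_distrib]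
  exact Finset.sum_congr rfl fun i _ => by ring

theorem deviation_sum_mul {ι : Type*} [Fintype ι] (hw : IsWindow K x₀ h)
    {Φ : ι → (Fin d → ℝ) × ℝ → ℝ} (hΦ : ∀ p, IsKernelDominated K x₀ h A (Φ p)) (s : ι → ℝ)
    (ω : Ω) :
    deviation ν Z (fun y => ∑ p, s p * Φ p y) ω = ∑ p, s p * deviation ν Z (Φ p) ω := by
  have hint (i : Fin n) : ∫ y, ∑ p, s p * Φ p y ∂obsLaw d (ν i) =
      ∑ p, s p * ∫ y, Φ p y ∂obsLaw d (ν i) := by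
    rw [integral_finsetSum _ fun p _ => ((hΦ p).integrable hw).const_mul _]
    simp_rw [integral_const_mul]
  simp only [deviation, hint, ← Finset.sum_sub_distrib, ← mul_sub, Finset.mul_sum]
  exact Finset.sum_comm

theorem deviation_kernel (hw : IsWindow K x₀ h) (ω : Ω) :
    deviation ν Z (fun y => K (rescale x₀ h y.1)) ω =
      ∑ i, K (rescale x₀ h (Z i ω).1) - n * h ^ d := by
  simp [deviation, hw.integral_kernel_obsLaw]

theorem abs_deviation_le (hw : IsWindow K x₀ h) (hΦ : IsKernelDominated K x₀ h A Φ) (ω : Ω) :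
    |deviation ν Z Φ ω| ≤
      A * (deviation ν Z (fun y => K (rescale x₀ h y.1)) ω + 2 * (n * h ^ d)) := by
  calc |deviation ν Z Φ ω| ≤ ∑ i, |Φ (Z i ω) - ∫ y, Φ y ∂obsLaw d (ν i)| :=
        Finset.abs_sum_le_sum_abs _ _
    _ ≤ ∑ i, (A * K (rescale x₀ h (Z i ω).1) + A * h ^ d) := by
        gcongr with i
        exact (abs_sub _ _).trans (add_le_add (hΦ.abs_le _) (hΦ.abs_integral_le hw))
    _ = _ := by
        rw [deviation_kernel hw, Finset.sum_add_distrib, ← Finset.mul_sum]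
        simp only [Finset.sum_const, Finset.card_univ, Fintype.card_fin, nsmul_eq_mul]
        ring

variable [MeasurableSpace Ω] {P : Measure Ω}

omit [∀ i, IsProbabilityMeasure (ν i)] in
theorem IsSample.integral_comp (hZ : IsSample P ν Z) (hΦ : Measurable Φ) (i : Fin n) :
    ∫ ω, Φ (Z i ω) ∂P = ∫ y, Φ y ∂obsLaw d (ν i) := by
  rw [← hZ.law i, integral_map (hZ.measurable i).aemeasurable hΦ.aestronglyMeasurable]

theorem IsSample.measureReal_deviation_ge_le [IsProbabilityMeasure P] (hZ : IsSample P ν Z)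
    (hn : 0 < n) (hw : IsWindow K x₀ h) (hA : 0 < A) (hΦ : IsKernelDominated K x₀ h A Φ) {u : ℝ}
    (hu : 0 ≤ u) :
    P.real {ω | √(n * h ^ d) * u ≤ |deviation ν Z Φ ω|} ≤
      2 * Real.exp (-bernsteinExponent (supNorm K) √(n * h ^ d) A u) := by
  set κ := supNorm K
  set m : ℝ := n * h ^ d with hm
  have hκ : 0 < κ := zero_lt_one.trans_le hw.isKernel.one_le_supNorm
  have hm0 : 0 < m := mul_pos (Nat.cast_pos.2 hn) (pow_pos hw.pos d)
  have hbound := hΦ.abs_le_mul_supNorm hw hA.le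
  set Y : Fin n → Ω → ℝ := fun i ω => Φ (Z i ω) - ∫ y, Φ y ∂obsLaw d (ν i) with hY
  have hΦm (i : Fin n) : Measurable fun ω => Φ (Z i ω) := hΦ.measurable.comp (hZ.measurable i)
  have hΦL (i : Fin n) : Integrable (fun ω => Φ (Z i ω)) P :=
    .of_bound (hΦm i).aestronglyMeasurable (A * κ) (ae_of_all _ fun ω => hbound _)
  have hYbound (i : Fin n) (ω : Ω) : |Y i ω| ≤ 2 * (A * κ) := by
    have hmean : |∫ y, Φ y ∂obsLaw d (ν i)| ≤ A * κ := by
      simpa using norm_integral_le_of_norm_le_const (f := Φ)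
        (ae_of_all (obsLaw d (ν i)) hbound)
    linarith [abs_sub (Φ (Z i ω)) (∫ y, Φ y ∂obsLaw d (ν i)), hbound (Z i ω)]
  have hYmean (i : Fin n) : ∫ ω, Y i ω ∂P = 0 := by
    simp [hY, integral_sub (hΦL i) (integrable_const _), hZ.integral_comp hΦ.measurable i]
  have hYsq (i : Fin n) : ∫ ω, Y i ω ^ 2 ∂P ≤ A ^ 2 * κ * h ^ d := by
    have hvar := variance_le_expectation_sq (hΦm i).aestronglyMeasurable (μ := P)
    rw [variance_eq_integral (hΦm i).aemeasurable, hZ.integral_comp hΦ.measurable i] at hvar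
    refine hvar.trans (le_trans (le_of_eq ?_) (hΦ.integral_sq_le hw (ν := ν i)))
    exact hZ.integral_comp (hΦ.measurable.pow_const 2) i
  have hsum : ∑ i, ∫ ω, Y i ω ^ 2 ∂P ≤ A ^ 2 * κ * m := by
    refine (Finset.sum_le_sum fun i _ => hYsq i).trans_eq ?_
    rw [Finset.sum_const, Finset.card_univ, Fintype.card_fin, nsmul_eq_mul, hm]
    ring
  refine (bernstein_abs_sum_ge
    (hZ.indep.comp (fun i y => Φ y - ∫ y, Φ y ∂obsLaw d (ν i)) fun i =>
      hΦ.measurable.sub_const _)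
    (fun i => (hΦm i).sub_const _) (by positivity) (fun i => ae_of_all _ (hYbound i)) hYmean
    (by positivity) hsum (by positivity)).trans_eq ?_
  congr 3
  have hden : 2 * (A ^ 2 * κ * m + 2 * (A * κ) * (√m * u) / 3) =
      m * (2 * (A ^ 2 * κ + 2 * A * κ * u / (3 * √m))) := by
    have hsqrt := Real.mul_self_sqrt hm0.le
    field_simp
    linear_combination (2 * u) * hsqrt
  rw [hden, mul_pow, Real.sq_sqrt hm0.le, bernsteinExponent, mul_div_mul_left _ _ hm0.ne']

end Deviation

/-! ### Localization of the deviations -/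

theorem abs_le_sqrt_sum_sq {ι : Type*} [Fintype ι] (s : ι → ℝ) (p : ι) :
    |s p| ≤ √(∑ q, s q ^ 2) :=
  Real.abs_le_sqrt (Finset.single_le_sum (f := fun q => s q ^ 2) (fun _ _ => sq_nonneg _)
    (Finset.mem_univ p))

theorem sum_abs_le_card_mul_sqrt_sum_sq {ι : Type*} [Fintype ι] (s : ι → ℝ) :
    ∑ p, |s p| ≤ Fintype.card ι * √(∑ p, s p ^ 2) := by
  simpa using Finset.sum_le_card_nsmul Finset.univ _ _ fun p _ => abs_le_sqrt_sum_sq s p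

theorem exists_le_abs_of_mul_sum_abs_le {ι : Type*} [Fintype ι] {s D : ι → ℝ} {y : ℝ}
    (hs : 0 < ∑ p, |s p|) (hD : y * ∑ p, |s p| ≤ ∑ p, s p * D p) : ∃ p, y ≤ |D p| := by
  by_contra! hlt
  obtain ⟨p, -, hp⟩ := Finset.exists_ne_zero_of_sum_ne_zero hs.ne'
  refine hD.not_gt ?_
  rw [Finset.mul_sum]
  have hle (q : ι) : s q * D q ≤ |D q| * |s q| := by
    rw [mul_comm, ← abs_mul]
    exact le_abs_self _
  exact Finset.sum_lt_sum
    (fun q _ => (hle q).trans (mul_le_mul_of_nonneg_right (hlt q).le (abs_nonneg _)))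
    ⟨p, Finset.mem_univ p, (hle p).trans_lt
      (mul_lt_mul_of_pos_right (hlt p) ((abs_nonneg _).lt_of_ne' hp))⟩

theorem exists_finset_sphere_net (ι : Type*) [Fintype ι] {η : ℝ} (hη : 0 < η) :
    ∃ F : Finset (ι → ℝ), (∀ v ∈ F, ∑ p, v p ^ 2 = 1) ∧
      ∀ u : ι → ℝ, ∑ p, u p ^ 2 = 1 → ∃ v ∈ F, ∑ p, |u p - v p| < η := by
  have hcompact : IsCompact {u : ι → ℝ | ∑ p, u p ^ 2 = 1} := by
    refine Metric.isCompact_of_isClosed_isBounded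
      (isClosed_eq (by fun_prop) continuous_const) (Metric.isBounded_iff_subset_closedBall 0 |>.2
        ⟨1, fun u hu => ?_⟩)
    rw [mem_closedBall_zero_iff, pi_norm_le_iff_of_nonneg zero_le_one]
    intro p
    simpa [show ∑ p, u p ^ 2 = 1 from hu] using abs_le_sqrt_sum_sq u p
  obtain ⟨F, hF, hcover⟩ := hcompact.elim_nhds_subcover (fun v => {u | ∑ p, |u p - v p| < η})
    fun v _ => (isOpen_lt (by fun_prop) continuous_const).mem_nhds (by simpa using hη)
  refine ⟨F, hF, fun u hu => ?_⟩
  simpa using hcover hu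

theorem one_le_numIdx (d b : ℕ) : (1 : ℝ) ≤ numIdx d b := by
  exact_mod_cast Finset.card_pos.2 ⟨_, (zeroIdx d b).2⟩

theorem card_multiIdx (d b : ℕ) : Fintype.card (multiIdx d b) = numIdx d b := by
  simp [numIdx]

section Localization

variable {Ω : Type*} {d n b : ℕ} {ν : Fin n → Measure ℝ} [∀ i, IsProbabilityMeasure (ν i)]
  {Z : Fin n → Ω → (Fin d → ℝ) × ℝ} {ψ : ℝ → ℝ} {R : ℝ} {K : (Fin d → ℝ) → ℝ} {x₀ : Fin d → ℝ}
  {h κ w₀ β : ℝ} {f : (Fin d → ℝ) → ℝ} {θ : multiIdx d b → ℝ}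

theorem le_sum_mul_deviation_scoreTerm (hw : IsWindow K x₀ h) (hψ : IsBoundedScore ψ R)
    (hf : Measurable f) (hκ : 0 ≤ κ) (hslope : ∀ i, HasScoreSlope ψ (ν i) κ w₀)
    (hβ : ∀ x ∈ nbhd x₀ h, |f x - localPoly x₀ h θ x| ≤ β) {s : multiIdx d b → ℝ}
    (hs : ∑ p, |s p| ≤ w₀) {ω : Ω}
    (hnonneg : 0 ≤ ∑ i, ∑ p, s p * scoreTerm ψ K x₀ h f (θ + s) p (Z i ω)) :
    n * h ^ d * (κ * (minEigen b K * ∑ p, s p ^ 2) - β * ∑ p, |s p|) ≤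
      ∑ p, s p * deviation ν Z (scoreTerm ψ K x₀ h f (θ + s) p) ω := by
  have hdrift : ∑ i, ∫ y, ∑ p, s p * scoreTerm ψ K x₀ h f (θ + s) p y ∂obsLaw d (ν i) ≤
      n * (h ^ d * (β * ∑ p, |s p| - κ * (minEigen b K * ∑ p, s p ^ 2))) := by
    simpa using Finset.sum_le_card_nsmul Finset.univ _ _ fun i _ =>
      integral_sum_mul_scoreTerm_le hw hψ hf hκ (hslope i) hβ hs
  rw [← deviation_sum_mul hw (isKernelDominated_scoreTerm hw.isKernel hψ hf _), deviation,
    Finset.sum_sub_distrib]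
  linarith

theorem exists_le_abs_deviation (hn : 0 < n) {ρ : ℝ → ℝ} (hconv : ConvexOn ℝ Set.univ ρ)
    (hdiff : Differentiable ℝ ρ) (hscore : IsBoundedScore (deriv ρ) R) (hw : IsWindow K x₀ h)
    (hf : Measurable f) (hκ : 0 ≤ κ) (hslope : ∀ i, HasScoreSlope (deriv ρ) (ν i) κ w₀)
    (hβ : ∀ x ∈ nbhd x₀ h, |f x - localPoly x₀ h θ x| ≤ β) {M : ℝ} (hθ : θ ∈ paramSet d b M)
    {t : multiIdx d b → ℝ} {ω : Ω}
    (ht : IsLocalMEstimate ρ K M x₀ h (fun i => (Z i ω).1) (fun i => f (Z i ω).1 + (Z i ω).2) t)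
    {r : ℝ} (hr : 0 < r) (hrt : r ≤ √(∑ p, (t p - θ p) ^ 2)) (hrw : numIdx d b * r ≤ w₀) :
    ∃ u : multiIdx d b → ℝ, ∑ p, u p ^ 2 = 1 ∧ ∃ p,
      n * h ^ d * (κ * minEigen b K / numIdx d b * r - β) ≤
        |deviation ν Z (scoreTerm (deriv ρ) K x₀ h f (θ + r • u) p) ω| := by
  set T := √(∑ p, (t p - θ p) ^ 2)
  have hT0 : 0 < T := hr.trans_le hrt
  have hTsq : T ^ 2 = ∑ p, (t p - θ p) ^ 2 :=
    Real.sq_sqrt (Finset.sum_nonneg fun _ _ => sq_nonneg _)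
  set u : multiIdx d b → ℝ := T⁻¹ • (t - θ) with hu
  have husq : ∑ p, u p ^ 2 = 1 := by
    simp only [hu, Pi.smul_apply, Pi.sub_apply, smul_eq_mul, mul_pow, ← Finset.mul_sum, ← hTsq]
    field_simp
  refine ⟨u, husq, ?_⟩
  have hssq : ∑ p, (r • u) p ^ 2 = r ^ 2 := by
    simp only [Pi.smul_apply, smul_eq_mul, mul_pow, ← Finset.mul_sum, husq, mul_one]
  have hnorm : √(∑ p, (r • u) p ^ 2) = r := by rw [hssq, Real.sqrt_sq hr.le]
  have hsum : ∑ p, |(r • u) p| ≤ numIdx d b * r := by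
    simpa only [hnorm, card_multiIdx] using sum_abs_le_card_mul_sqrt_sum_sq (r • u)
  have hpos : 0 < ∑ p, |(r • u) p| := by
    refine (Finset.sum_nonneg fun _ _ => abs_nonneg _).lt_of_ne' fun hzero => ?_
    have hz := (Finset.sum_eq_zero_iff_of_nonneg fun _ _ => abs_nonneg _).1 hzero
    refine (pow_pos hr 2).ne' (hssq.symm.trans (Finset.sum_eq_zero fun p hp => ?_))
    simpa using hz p hp
  have hscale : r • u = (r / T) • (t - θ) := by rw [hu, smul_smul, div_eq_mul_inv]
  have hnonneg := sum_scoreTerm_nonneg hn hconv hdiff hw (e := fun i => (Z i ω).2) hθ ht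
    (div_nonneg hr.le hT0.le) ((div_le_one hT0).2 hrt)
  rw [← hscale] at hnonneg
  refine exists_le_abs_of_mul_sum_abs_le hpos (le_trans ?_
    (le_sum_mul_deviation_scoreTerm hw hscore hf hκ hslope hβ (hsum.trans hrw) hnonneg))
  rw [hssq, mul_assoc]
  have hm : 0 ≤ (n : ℝ) * h ^ d := mul_nonneg (Nat.cast_nonneg _) (pow_pos hw.pos d).le
  refine mul_le_mul_of_nonneg_left ?_ hm
  have hN : (0 : ℝ) < numIdx d b := one_pos.trans_le (one_le_numIdx d b)
  have hgain : κ * minEigen b K / numIdx d b * r * ∑ p, |(r • u) p| ≤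
      κ * minEigen b K / numIdx d b * r * (numIdx d b * r) := by
    have := hw.isKernel.minEigen_pos (b := b)
    gcongr
  calc (κ * minEigen b K / numIdx d b * r - β) * ∑ p, |(r • u) p|
      ≤ κ * minEigen b K / numIdx d b * r * (numIdx d b * r) - β * ∑ p, |(r • u) p| := by
        linarith
    _ = _ := by field_simp

/-- Chaining in one step: a deviation of size `√m y` on the sphere of radius `r` around `θ` comes
from the design, from the centre `θ`, or from a point of a net of the sphere. -/
theorem exists_deviation_of_net (hn : 0 < n) (hw : IsWindow K x₀ h) (hψ : IsBoundedScore ψ R)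
    (hf : Measurable f) {F : Finset (multiIdx d b → ℝ)} {η r y : ℝ} (hr : 0 < r)
    {u : multiIdx d b → ℝ} (hF : ∃ v ∈ F, ∑ p, |u p - v p| < η)
    (hη : 3 * (r * η) * √(n * h ^ d) ≤ y / 4) {p : multiIdx d b} {ω : Ω}
    (hdev : √(n * h ^ d) * y ≤ |deviation ν Z (scoreTerm ψ K x₀ h f (θ + r • u) p) ω|) :
    √(n * h ^ d) * √(n * h ^ d) ≤ |deviation ν Z (fun y => K (rescale x₀ h y.1)) ω| ∨
      √(n * h ^ d) * (y / 2) ≤ |deviation ν Z (scoreTerm ψ K x₀ h f θ p) ω| ∨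
      ∃ v ∈ F, √(n * h ^ d) * (y / 4) ≤ |deviation ν Z (fun y =>
        scoreTerm ψ K x₀ h f (θ + r • v) p y - scoreTerm ψ K x₀ h f θ p y) ω| := by
  obtain ⟨v, hv, huv⟩ := hF
  by_contra! hcon
  obtain ⟨hker, hcen, hnet⟩ := hcon
  replace hnet := hnet v hv
  set m : ℝ := n * h ^ d with hm
  have hm0 : 0 < m := mul_pos (Nat.cast_pos.2 hn) (pow_pos hw.pos d)
  have hsq : √m * √m = m := Real.mul_self_sqrt hm0.le
  have hdom (t : multiIdx d b → ℝ) : IsKernelDominated K x₀ h R (scoreTerm ψ K x₀ h f t p) :=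
    isKernelDominated_scoreTerm hw.isKernel hψ hf t p
  have hl1 : ∑ q, |(θ + r • u) q - (θ + r • v) q| = r * ∑ q, |u q - v q| := by
    simp [← mul_sub, abs_mul, abs_of_pos hr, Finset.mul_sum]
  have hosc := abs_deviation_le (ν := ν) (Z := Z) hw
    (isKernelDominated_scoreTerm_sub hw hψ hf (θ + r • u) (θ + r • v) p) ω
  rw [deviation_sub hw (hdom _) (hdom _), hl1, ← hm] at hosc
  rw [deviation_sub hw (hdom _) (hdom _)] at hnet
  have hlt : deviation ν Z (fun y => K (rescale x₀ h y.1)) ω < m :=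
    (le_abs_self _).trans_lt (hker.trans_eq hsq)
  have hsmall : |deviation ν Z (scoreTerm ψ K x₀ h f (θ + r • u) p) ω -
      deviation ν Z (scoreTerm ψ K x₀ h f (θ + r • v) p) ω| ≤ √m * (y / 4) := by
    calc _ ≤ r * (∑ q, |u q - v q|) *
          (deviation ν Z (fun y => K (rescale x₀ h y.1)) ω + 2 * m) := hosc
      _ ≤ r * (∑ q, |u q - v q|) * (3 * m) := by
          gcongr
          linarith
      _ ≤ r * η * (3 * m) := by gcongr
      _ = √m * (3 * (r * η) * √m) := by linear_combination (-3 * (r * η)) * hsq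
      _ ≤ √m * (y / 4) := by gcongr
  have htri := abs_add_three
    (deviation ν Z (scoreTerm ψ K x₀ h f (θ + r • u) p) ω -
      deviation ν Z (scoreTerm ψ K x₀ h f (θ + r • v) p) ω)
    (deviation ν Z (scoreTerm ψ K x₀ h f (θ + r • v) p) ω -
      deviation ν Z (scoreTerm ψ K x₀ h f θ p) ω)
    (deviation ν Z (scoreTerm ψ K x₀ h f θ p) ω)
  rw [sub_add_sub_cancel, sub_add_cancel] at htri
  linarith

end Localization

/-! ### Comparison of exponents -/

/-- The exponent of the deviation inequality, in terms of `x = c lam ε / (2 N)`; `q` is the square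
root of the effective sample size, `R` bounds the score and `κ` the kernel. -/
def deviationExponent (κ q R x a : ℝ) : ℝ :=
  (x - a) ^ 2 / (8 * κ ^ 2 * R ^ 2 + 8 * κ * R * x / (3 * q))

section Exponents

variable {κ q R x a A A₀ B Q : ℝ}

theorem deviationExponent_le_bernsteinExponent_half (hκ : 1 ≤ κ) (hR : 0 < R) (hq : 0 < q)
    (ha : 0 ≤ a) (hax : a ≤ x) :
    deviationExponent κ q R x a ≤ bernsteinExponent κ q R ((x - a) / 2) := by
  have : 0 ≤ x - a := sub_nonneg.2 hax
  have hrw : bernsteinExponent κ q R ((x - a) / 2) =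
      (x - a) ^ 2 / (8 * κ * R ^ 2 + 8 * κ * R * (x - a) / (3 * q)) := by
    rw [bernsteinExponent, div_pow, div_div]
    congr 1
    ring
  rw [hrw, deviationExponent]
  gcongr
  · exact le_self_pow₀ hκ two_ne_zero
  · linarith

theorem deviationExponent_le_sq (hκ : 1 ≤ κ) (hR : 1 ≤ R) (hq : 0 < q) (hx : 0 ≤ x) :
    deviationExponent κ q R x a ≤ (x - a) ^ 2 / 8 := by
  refine div_le_div_of_nonneg_left (sq_nonneg _) (by norm_num) ?_
  have hκR : 1 ≤ κ ^ 2 * R ^ 2 :=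
    one_le_mul_of_one_le_of_one_le (one_le_pow₀ hκ) (one_le_pow₀ hR)
  have : 0 ≤ 8 * κ * R * x / (3 * q) := by positivity
  linarith

theorem deviationExponent_le_bernsteinExponent_kernel (hκ : 1 ≤ κ) (hR : 1 ≤ R) (hq : 0 < q)
    (ha : 0 ≤ a) (hax : a ≤ x) (hxq : κ * x ≤ q) :
    deviationExponent κ q R x a ≤ bernsteinExponent κ q 1 q := by
  have hbern : bernsteinExponent κ q 1 q = 3 * q ^ 2 / (10 * κ) := by
    rw [bernsteinExponent]
    field_simp
    ring
  have hsq : κ * (x - a) ^ 2 ≤ q ^ 2 := by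
    calc κ * (x - a) ^ 2 ≤ κ ^ 2 * (x - a) ^ 2 := by
          gcongr
          exact le_self_pow₀ hκ two_ne_zero
      _ = (κ * (x - a)) ^ 2 := by ring
      _ ≤ q ^ 2 := by
          have : 0 ≤ x - a := sub_nonneg.2 hax
          have : κ * (x - a) ≤ κ * x := by
            gcongr
            linarith
          gcongr
          linarith
  refine (deviationExponent_le_sq hκ hR hq (ha.trans hax)).trans ?_
  rw [hbern, div_le_div_iff₀ (by norm_num) (by positivity)]
  nlinarith [sq_nonneg q]

theorem deviationExponent_add_le_bernsteinExponent_quarter (hκ : 1 ≤ κ) (hR : 1 ≤ R) (hq : 0 < q)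
    (ha : 0 ≤ a) (hax : 1 ≤ x - a) (hA : 0 < A) (hAA₀ : A ≤ A₀) (hxB : x / q ≤ B) (hQ : 0 ≤ Q)
    (hsmall : 32 * κ * (A₀ ^ 2 + A₀ * B / 6) * (1 + Q) ≤ 1) :
    deviationExponent κ q R x a + Q ≤ bernsteinExponent κ q A ((x - a) / 4) := by
  have hx : 0 ≤ x := by linarith
  have : 0 ≤ A₀ := hA.le.trans hAA₀
  have hden : A ^ 2 * κ + 2 * A * κ * ((x - a) / 4) / (3 * q) ≤ κ * (A₀ ^ 2 + A₀ * B / 6) := by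
    have hB : (x - a) / q ≤ B := le_trans (by gcongr; linarith) hxB
    calc A ^ 2 * κ + 2 * A * κ * ((x - a) / 4) / (3 * q)
        = κ * (A ^ 2 + A * ((x - a) / q) / 6) := by field_simp; ring
      _ ≤ κ * (A₀ ^ 2 + A₀ * B / 6) := by gcongr
  have hlow : (x - a) ^ 2 * (1 + Q) ≤ bernsteinExponent κ q A ((x - a) / 4) := by
    rw [bernsteinExponent, le_div_iff₀ (by positivity)]
    calc (x - a) ^ 2 * (1 + Q) * (2 * (A ^ 2 * κ + 2 * A * κ * ((x - a) / 4) / (3 * q)))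
        ≤ (x - a) ^ 2 * (1 + Q) * (2 * (κ * (A₀ ^ 2 + A₀ * B / 6))) := by gcongr
      _ = (x - a) ^ 2 / 16 * (32 * κ * (A₀ ^ 2 + A₀ * B / 6) * (1 + Q)) := by ring
      _ ≤ (x - a) ^ 2 / 16 * 1 := by gcongr
      _ = ((x - a) / 4) ^ 2 := by ring
  have hQy : Q ≤ (x - a) ^ 2 * Q := le_mul_of_one_le_left hQ (one_le_pow₀ hax)
  have hsq := deviationExponent_le_sq (a := a) hκ hR hq hx
  linarith [sq_nonneg (x - a)]

end Exponents

/-! ### The deviation inequality for a fixed net -/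

theorem measureReal_union_net_le {Ω ι α : Type*} [MeasurableSpace Ω] {P : Measure Ω}
    [IsFiniteMeasure P] [Fintype ι] {F : Finset α} {A : Set Ω} {C : ι → Set Ω} {D : ι → α → Set Ω}
    {s : ℝ} (hs : 0 ≤ s) (hA : P.real A ≤ 2 * s) (hC : ∀ p, P.real (C p) ≤ 2 * s)
    (hD : ∀ p, ∀ v ∈ F, P.real (D p v) ≤ 2 * (s * Real.exp (-F.card))) :
    P.real (A ∪ ((⋃ p, C p) ∪ ⋃ p, ⋃ v ∈ F, D p v)) ≤ (2 + 4 * Fintype.card ι) * s := by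
  have hCs : P.real (⋃ p, C p) ≤ Fintype.card ι * (2 * s) := by
    refine (measureReal_iUnion_fintype_le _).trans ?_
    simpa using Finset.sum_le_card_nsmul Finset.univ _ _ fun p _ => hC p
  have hFexp : (F.card : ℝ) * Real.exp (-F.card) ≤ 1 := by
    rw [Real.exp_neg, ← div_eq_mul_inv, div_le_one (Real.exp_pos _)]
    linarith [Real.add_one_le_exp (F.card : ℝ)]
  have hDp (p : ι) : P.real (⋃ v ∈ F, D p v) ≤ 2 * s := by
    calc P.real (⋃ v ∈ F, D p v) ≤ ∑ v ∈ F, P.real (D p v) := measureReal_biUnion_finset_le F _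
      _ ≤ F.card * (2 * (s * Real.exp (-F.card))) := by
          simpa using Finset.sum_le_card_nsmul F _ _ (hD p)
      _ = 2 * s * (F.card * Real.exp (-F.card)) := by ring
      _ ≤ 2 * s := mul_le_of_le_one_right (by positivity) hFexp
  have hDs : P.real (⋃ p, ⋃ v ∈ F, D p v) ≤ Fintype.card ι * (2 * s) := by
    refine (measureReal_iUnion_fintype_le _).trans ?_
    simpa using Finset.sum_le_card_nsmul Finset.univ _ _ fun p _ => hDp p
  calc P.real (A ∪ ((⋃ p, C p) ∪ ⋃ p, ⋃ v ∈ F, D p v))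
      ≤ P.real A + (P.real (⋃ p, C p) + P.real (⋃ p, ⋃ v ∈ F, D p v)) :=
        (measureReal_union_le _ _).trans (by gcongr; exact measureReal_union_le _ _)
    _ ≤ 2 * s + (Fintype.card ι * (2 * s) + Fintype.card ι * (2 * s)) := by gcongr
    _ = _ := by ring

/-- Radii `δ` around `θ` within which the averaged score is linear (`growth`), deviations of the
design are negligible (`design`), and the oscillation of the score is so small that its deviations
at `Q` net points are negligible (`net`). Here `N` is the dimension, `κ` bounds the kernel, and `γ`
is the slope of the averaged score. -/
structure IsLocalizationRadius (N κ γ w₀ : ℝ) (Q : ℕ) (δ : ℝ) : Prop where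
  growth : N * δ ≤ w₀
  design : κ * (γ * δ) ≤ 1
  net : 32 * κ * ((N * δ) ^ 2 + N * δ * (γ * δ) / 6) * (1 + Q) ≤ 1

theorem exists_isLocalizationRadius (N κ γ : ℝ) {w₀ : ℝ} (hw₀ : 0 < w₀) (Q : ℕ) :
    ∃ δ > 0, IsLocalizationRadius N κ γ w₀ Q δ := by
  have hlim {φ : ℝ → ℝ} (hφ : Continuous φ) {B : ℝ} (hB : φ 0 < B) : ∀ᶠ δ in 𝓝[>] 0, φ δ ≤ B :=
    ((hφ.tendsto 0).mono_left nhdsWithin_le_nhds).eventually_le_const hB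
  have hgrowth := hlim (φ := fun δ => N * δ) (by fun_prop) (by simpa using hw₀)
  have hdesign := hlim (φ := fun δ => κ * (γ * δ)) (B := 1) (by fun_prop) (by simp)
  have hnet := hlim (φ := fun δ => 32 * κ * ((N * δ) ^ 2 + N * δ * (γ * δ) / 6) * (1 + Q)) (B := 1)
    (by fun_prop) (by simp)
  obtain ⟨δ, hδ, h₁, h₂, h₃⟩ :=
    (eventually_mem_nhdsWithin.and (hgrowth.and (hdesign.and hnet))).exists
  exact ⟨δ, hδ, h₁, h₂, h₃⟩

section FixedNet

variable {Ω : Type*} {d n b : ℕ} {ν : Fin n → Measure ℝ} [∀ i, IsProbabilityMeasure (ν i)]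
  {Z : Fin n → Ω → (Fin d → ℝ) × ℝ} {ρ : ℝ → ℝ} {R : ℝ} {K : (Fin d → ℝ) → ℝ} {x₀ : Fin d → ℝ}
  {h κ w₀ β M γ δ ε a : ℝ} {f : (Fin d → ℝ) → ℝ} {θ : multiIdx d b → ℝ}
  {F : Finset (multiIdx d b → ℝ)}

theorem exists_deviation_of_far_estimate (hn : 0 < n) (hconv : ConvexOn ℝ Set.univ ρ)
    (hdiff : Differentiable ℝ ρ) (hscore : IsBoundedScore (deriv ρ) R) (hw : IsWindow K x₀ h)
    (hf : Measurable f) (hκ : 0 ≤ κ) (hslope : ∀ i, HasScoreSlope (deriv ρ) (ν i) κ w₀)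
    (hβ : ∀ x ∈ nbhd x₀ h, |f x - localPoly x₀ h θ x| ≤ β) (hθ : θ ∈ paramSet d b M)
    (hγ : γ = κ * minEigen b K / numIdx d b)
    (hF : ∀ u : multiIdx d b → ℝ, ∑ p, u p ^ 2 = 1 → ∃ v ∈ F, ∑ p, |u p - v p| < γ / 24)
    (hβa : β * √(n * h ^ d) ≤ a) (hax : 2 * a ≤ γ * ε) (hε : 0 < ε)
    {t : multiIdx d b → ℝ} {ω : Ω}
    (ht : IsLocalMEstimate ρ K M x₀ h (fun i => (Z i ω).1) (fun i => f (Z i ω).1 + (Z i ω).2) t)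
    (hεt : ε ≤ √(n * h ^ d) * √(∑ p, (t p - θ p) ^ 2))
    (hεw : numIdx d b * (ε / √(n * h ^ d)) ≤ w₀) :
    ∃ p, √(n * h ^ d) * √(n * h ^ d) ≤ |deviation ν Z (fun y => K (rescale x₀ h y.1)) ω| ∨
      √(n * h ^ d) * ((γ * ε - a) / 2) ≤
        |deviation ν Z (scoreTerm (deriv ρ) K x₀ h f θ p) ω| ∨
      ∃ v ∈ F, √(n * h ^ d) * ((γ * ε - a) / 4) ≤ |deviation ν Z (fun y =>
        scoreTerm (deriv ρ) K x₀ h f (θ + (ε / √(n * h ^ d)) • v) p y -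
          scoreTerm (deriv ρ) K x₀ h f θ p y) ω| := by
  set m : ℝ := n * h ^ d with hm
  have hm0 : 0 < m := mul_pos (Nat.cast_pos.2 hn) (pow_pos hw.pos d)
  have hq : 0 < √m := Real.sqrt_pos.2 hm0
  have hr : 0 < ε / √m := div_pos hε hq
  obtain ⟨u, hu, p, hp⟩ := exists_le_abs_deviation hn hconv hdiff hscore hw hf hκ hslope hβ hθ ht
    hr ((div_le_iff₀' hq).2 hεt) hεw
  have hη : 3 * (ε / √m * (γ / 24)) * √m ≤ (γ * ε - a) / 4 := by
    have hcancel : 3 * (ε / √m * (γ / 24)) * √m = γ * ε / 8 := by field_simp; ring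
    linarith
  have hgain : √m * (γ * ε - a) ≤ m * (γ * (ε / √m) - β) := by
    calc √m * (γ * ε - a) ≤ √m * (γ * ε - β * √m) := by gcongr
      _ = m * (γ * (ε / √m) - β) := by
          field_simp
          rw [Real.sq_sqrt hm0.le]
          ring
  rw [← hγ, ← hm] at hp
  exact ⟨p, exists_deviation_of_net hn hw hscore hf hr (hF u hu) hη (hgain.trans hp)⟩

variable [MeasurableSpace Ω] {P : Measure Ω} [IsProbabilityMeasure P]

theorem IsSample.measureReal_kernel_deviation_ge_le (hZ : IsSample P ν Z) (hn : 0 < n)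
    (hw : IsWindow K x₀ h) (hR : 1 ≤ R) {x : ℝ} (ha : 0 ≤ a) (hax : a ≤ x)
    (hx : supNorm K * x ≤ √(n * h ^ d)) :
    P.real {ω | √(n * h ^ d) * √(n * h ^ d) ≤
        |deviation ν Z (fun y => K (rescale x₀ h y.1)) ω|} ≤
      2 * Real.exp (-deviationExponent (supNorm K) √(n * h ^ d) R x a) := by
  have hq : 0 < √(n * h ^ d) := Real.sqrt_pos.2 (mul_pos (Nat.cast_pos.2 hn) (pow_pos hw.pos d))
  refine (hZ.measureReal_deviation_ge_le hn hw one_pos hw.isKernelDominated_kernel hq.le).trans ?_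
  gcongr
  exact deviationExponent_le_bernsteinExponent_kernel hw.isKernel.one_le_supNorm hR hq ha hax hx

theorem IsSample.measureReal_scoreTerm_deviation_ge_le (hZ : IsSample P ν Z) (hn : 0 < n)
    (hw : IsWindow K x₀ h) {ψ : ℝ → ℝ} (hψ : IsBoundedScore ψ R) (hf : Measurable f) (hR : 0 < R)
    {x : ℝ} (ha : 0 ≤ a) (hax : a ≤ x) (p : multiIdx d b) :
    P.real {ω | √(n * h ^ d) * ((x - a) / 2) ≤ |deviation ν Z (scoreTerm ψ K x₀ h f θ p) ω|} ≤
      2 * Real.exp (-deviationExponent (supNorm K) √(n * h ^ d) R x a) := by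
  have hq : 0 < √(n * h ^ d) := Real.sqrt_pos.2 (mul_pos (Nat.cast_pos.2 hn) (pow_pos hw.pos d))
  refine (hZ.measureReal_deviation_ge_le hn hw hR
    (isKernelDominated_scoreTerm hw.isKernel hψ hf θ p) (by linarith)).trans ?_
  gcongr
  exact deviationExponent_le_bernsteinExponent_half hw.isKernel.one_le_supNorm hR hq ha hax

theorem IsSample.measureReal_scoreTerm_sub_deviation_ge_le (hZ : IsSample P ν Z) (hn : 0 < n)
    (hw : IsWindow K x₀ h) {ψ : ℝ → ℝ} (hψ : IsBoundedScore ψ R) (hf : Measurable f) (hR : 1 ≤ R)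
    (ha : 0 ≤ a) (hax : 1 ≤ γ * ε - a) (hγ : 0 ≤ γ) (hε : 0 < ε) (hεδ : ε / √(n * h ^ d) ≤ δ)
    {Q : ℕ} (hδ : IsLocalizationRadius (numIdx d b) (supNorm K) γ w₀ Q δ) {v : multiIdx d b → ℝ}
    (hv : ∑ p, v p ^ 2 = 1) (p : multiIdx d b) :
    P.real {ω | √(n * h ^ d) * ((γ * ε - a) / 4) ≤ |deviation ν Z (fun y =>
        scoreTerm ψ K x₀ h f (θ + (ε / √(n * h ^ d)) • v) p y -
          scoreTerm ψ K x₀ h f θ p y) ω|} ≤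
      2 * (Real.exp (-deviationExponent (supNorm K) √(n * h ^ d) R (γ * ε) a) *
        Real.exp (-Q)) := by
  have hq : 0 < √(n * h ^ d) := Real.sqrt_pos.2 (mul_pos (Nat.cast_pos.2 hn) (pow_pos hw.pos d))
  set r := ε / √(n * h ^ d)
  have hr0 : 0 < r := div_pos hε hq
  have hN := one_le_numIdx d b
  have hl1 : ∑ q, |(θ + r • v) q - θ q| ≤ numIdx d b * r := by
    have hv1 : ∑ q, |v q| ≤ numIdx d b := by
      simpa only [card_multiIdx, hv, Real.sqrt_one, mul_one] using
        sum_abs_le_card_mul_sqrt_sum_sq v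
    calc ∑ q, |(θ + r • v) q - θ q| = (∑ q, |v q|) * r := by
          rw [Finset.sum_mul]
          exact Finset.sum_congr rfl fun q _ => by simp [abs_mul, abs_of_pos hr0, mul_comm]
      _ ≤ numIdx d b * r := by gcongr
  refine (hZ.measureReal_deviation_ge_le hn hw (A := numIdx d b * r) (by positivity)
    ((isKernelDominated_scoreTerm_sub hw hψ hf (θ + r • v) θ p).mono hw hl1)
    (by linarith)).trans ?_
  rw [← Real.exp_add, ← neg_add]
  gcongr
  refine deviationExponent_add_le_bernsteinExponent_quarter hw.isKernel.one_le_supNorm hR hq ha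
    hax (by positivity) (A₀ := numIdx d b * δ) (B := γ * δ) (by gcongr) ?_ (Nat.cast_nonneg _)
    hδ.net
  rw [mul_div_assoc]
  gcongr

theorem IsSample.measureReal_far_estimate_le (hZ : IsSample P ν Z) (hn : 0 < n)
    (hconv : ConvexOn ℝ Set.univ ρ) (hdiff : Differentiable ℝ ρ)
    (hscore : IsBoundedScore (deriv ρ) R) (hR : 1 ≤ R) (hw : IsWindow K x₀ h)
    (hf : Measurable f) (hκ : 0 ≤ κ) (hslope : ∀ i, HasScoreSlope (deriv ρ) (ν i) κ w₀)
    (hβ : ∀ x ∈ nbhd x₀ h, |f x - localPoly x₀ h θ x| ≤ β) (hθ : θ ∈ paramSet d b M)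
    (hγ : γ = κ * minEigen b K / numIdx d b) (hF1 : ∀ v ∈ F, ∑ p, v p ^ 2 = 1)
    (hF : ∀ u : multiIdx d b → ℝ, ∑ p, u p ^ 2 = 1 → ∃ v ∈ F, ∑ p, |u p - v p| < γ / 24)
    (hδ : IsLocalizationRadius (numIdx d b) (supNorm K) γ w₀ F.card δ)
    {θhat : Ω → multiIdx d b → ℝ} (hθhat : ∀ ω, IsLocalMEstimate ρ K M x₀ h
      (fun i => (Z i ω).1) (fun i => f (Z i ω).1 + (Z i ω).2) (θhat ω))
    (ha : 1 ≤ a) (hβa : β * √(n * h ^ d) ≤ a) (hax : 2 * a ≤ γ * ε) (hε : 0 < ε) :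
    P.real {ω | ε ≤ √(n * h ^ d) * √(∑ p, (θhat ω p - θ p) ^ 2) ∧ θhat ω ∈ paramBall M θ δ} ≤
      (2 + 4 * numIdx d b) *
        Real.exp (-deviationExponent (supNorm K) √(n * h ^ d) R (γ * ε) a) := by
  set m : ℝ := n * h ^ d
  have hq : 0 < √m := Real.sqrt_pos.2 (mul_pos (Nat.cast_pos.2 hn) (pow_pos hw.pos d))
  rcases lt_or_ge (√m * δ) ε with hδε | hεδ
  · have hempty : {ω | ε ≤ √m * √(∑ p, (θhat ω p - θ p) ^ 2) ∧ θhat ω ∈ paramBall M θ δ} = ∅ :=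
      Set.eq_empty_of_forall_notMem fun ω hω =>
        hδε.not_ge (hω.1.trans (mul_le_mul_of_nonneg_left hω.2.2 hq.le))
    rw [hempty, measureReal_empty]
    positivity
  have hγ0 : 0 < γ := pos_of_mul_pos_left (by linarith) hε.le
  have hκ1 := hw.isKernel.one_le_supNorm
  have hrδ : ε / √m ≤ δ := (div_le_iff₀' hq).2 hεδ
  have hdesign : supNorm K * (γ * ε) ≤ √m := by
    calc supNorm K * (γ * ε) ≤ supNorm K * (γ * (√m * δ)) := by gcongr
      _ = √m * (supNorm K * (γ * δ)) := by ring
      _ ≤ √m := mul_le_of_le_one_right hq.le hδ.design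
  rw [← card_multiIdx]
  refine (measureReal_mono fun ω hω => ?_).trans (measureReal_union_net_le (Real.exp_pos _).le
    (hZ.measureReal_kernel_deviation_ge_le hn hw hR (by linarith) (by linarith) hdesign)
    (hZ.measureReal_scoreTerm_deviation_ge_le (θ := θ) hn hw hscore hf (by linarith) (by linarith)
      (by linarith))
    fun p v hv => hZ.measureReal_scoreTerm_sub_deviation_ge_le (θ := θ) hn hw hscore hf hR
      (by linarith) (by linarith) hγ0.le hε hrδ hδ (hF1 v hv) p)
  obtain ⟨p, hker | hcen | ⟨v, hv, hnet⟩⟩ := exists_deviation_of_far_estimate hn hconv hdiff hscore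
    hw hf hκ hslope hβ hθ hγ hF hβa hax hε (hθhat ω) hω.1 (le_trans (by gcongr) hδ.growth)
  · exact Or.inl hker
  · exact Or.inr (Or.inl (Set.mem_iUnion.2 ⟨p, hcen⟩))
  · exact Or.inr (Or.inr (Set.mem_iUnion.2 ⟨p, Set.mem_iUnion₂.2 ⟨v, hv, hnet⟩⟩))

end FixedNet

/-! ### The constants of the statement -/

theorem deviationBound_eq {N S c lam κ R m β ε : ℝ} (hR : 0 ≤ R) :
    deviationBound N S c lam κ R m β ε = N * S * Real.exp
      (-deviationExponent κ √m (max 1 R) (c * lam / (2 * N) * ε) (max 1 (β * √m))) := by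
  have hsq : max 1 (R ^ 2) = max 1 R ^ 2 := by
    simpa using (pow_left_monotoneOn (n := 2)).map_max (Set.mem_Ici.2 zero_le_one)
      (Set.mem_Ici.2 hR) |>.symm
  rw [deviationBound, deviationExponent, hsq]
  congr 4
  ring

theorem deviationBound_le_deviationBound {N S S' c lam κ R m β ε : ℝ} (hN : 0 ≤ N) (hS : S ≤ S') :
    deviationBound N S c lam κ R m β ε ≤ deviationBound N S' c lam κ R m β ε := by
  unfold deviationBound
  gcongr

theorem exp_neg_le_six_div_cube {y : ℝ} (hy : 0 < y) : Real.exp (-y) ≤ 6 / y ^ 3 := by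
  have hcube := Real.pow_div_factorial_le_exp y hy.le 3
  rw [Real.exp_neg, inv_le_comm₀ (Real.exp_pos _) (by positivity), inv_div]
  simpa [Nat.factorial] using hcube

/-- The term of index `l = k + 1` of the series in the definition of `Σ`. -/
def sigmaTerm (d : ℕ) (κ : ℝ) (k : ℕ) : ℝ :=
  (d : ℝ) ^ 2 * 10 ^ (2 * (k + 1) - 1) *
    Real.exp (-((18 * 10 ^ (k + 1)) / (Real.pi ^ 4 * ((k : ℝ) + 1) ^ 4) *
      ((8 * κ)⁻¹ / (κ + 1 / 3))))

theorem sigmaTerm_nonneg (d : ℕ) (κ : ℝ) (k : ℕ) : 0 ≤ sigmaTerm d κ k := by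
  unfold sigmaTerm
  positivity

theorem summable_sigmaTerm (d : ℕ) {κ : ℝ} (hκ : 0 < κ) : Summable (sigmaTerm d κ) := by
  set A : ℝ := 18 / Real.pi ^ 4 * ((8 * κ)⁻¹ / (κ + 1 / 3)) with hA
  have hA0 : 0 < A := by positivity
  have hgeom : Summable fun k : ℕ => (d : ℝ) ^ 2 * (6 / A ^ 3) *
      (((k + 1 : ℕ) : ℝ) ^ 12 * (1 / 10) ^ (k + 1)) :=
    ((summable_nat_add_iff 1).2 (summable_pow_mul_geometric_of_norm_lt_one 12 (r := (1 / 10 : ℝ))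
      (by norm_num))).mul_left _
  refine hgeom.of_nonneg_of_le (sigmaTerm_nonneg d κ) fun k => ?_
  have hpow : (10 : ℝ) ^ (2 * (k + 1) - 1) ≤ (10 ^ (k + 1)) ^ 2 := by
    rw [← pow_mul, mul_comm]
    exact pow_le_pow_right₀ (by norm_num) (by omega)
  have hexponent : (18 * 10 ^ (k + 1)) / (Real.pi ^ 4 * ((k : ℝ) + 1) ^ 4) *
      ((8 * κ)⁻¹ / (κ + 1 / 3)) = A * (10 ^ (k + 1) / ((k : ℝ) + 1) ^ 4) := by
    rw [hA]
    field_simp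
  calc sigmaTerm d κ k
      ≤ (d : ℝ) ^ 2 * (10 ^ (k + 1)) ^ 2 *
          (6 / (A * (10 ^ (k + 1) / ((k : ℝ) + 1) ^ 4)) ^ 3) := by
        rw [sigmaTerm, hexponent]
        gcongr
        exact exp_neg_le_six_div_cube (by positivity)
    _ = _ := by
        rw [one_div, inv_pow]
        push_cast
        field_simp

theorem two_le_sigmaTerm_zero {d : ℕ} (hd : 0 < d) {κ : ℝ} (hκ : 1 ≤ κ) :
    2 ≤ sigmaTerm d κ 0 := by
  have hd1 : (1 : ℝ) ≤ (d : ℝ) ^ 2 := one_le_pow₀ (by exact_mod_cast hd)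
  have hpi : (3 : ℝ) ^ 4 ≤ Real.pi ^ 4 := by
    gcongr
    exact Real.pi_gt_three.le
  have hfrac : (8 * κ)⁻¹ / (κ + 1 / 3) ≤ 1 / 8 := by
    rw [div_le_iff₀ (by positivity), inv_le_iff_one_le_mul₀ (by positivity)]
    nlinarith
  have hexponent : (18 * 10 ^ (0 + 1)) / (Real.pi ^ 4 * (((0 : ℕ) : ℝ) + 1) ^ 4) *
      ((8 * κ)⁻¹ / (κ + 1 / 3)) ≤ 1 := by
    calc _ ≤ (18 * 10 ^ (0 + 1)) / (3 ^ 4 * (((0 : ℕ) : ℝ) + 1) ^ 4) * (1 / 8) := by gcongr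
      _ ≤ 1 := by norm_num
  have hexp : (1 : ℝ) / 5 ≤ Real.exp (-1) := by
    rw [Real.exp_neg, one_div]
    exact inv_anti₀ (Real.exp_pos _) (by linarith [Real.exp_one_lt_d9])
  calc (2 : ℝ) = 1 * 10 ^ (2 * (0 + 1) - 1) * (1 / 5) := by norm_num
    _ ≤ sigmaTerm d κ 0 := by
        unfold sigmaTerm
        gcongr
        exact hexp.trans (Real.exp_le_exp.2 (neg_le_neg hexponent))

theorem six_le_sigmaConst {d : ℕ} (hd : 0 < d) {κ : ℝ} (hκ : 1 ≤ κ) : 6 ≤ sigmaConst d κ := by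
  have hzero := two_le_sigmaTerm_zero hd hκ
  have hle := (summable_sigmaTerm d (one_pos.trans_le hκ)).le_tsum 0 fun k _ =>
    sigmaTerm_nonneg d κ k
  calc (6 : ℝ) ≤ 2 + 2 * ∑' k, sigmaTerm d κ k := by linarith
    _ = sigmaConst d κ := rfl

/-! ### The data of the statement -/

theorem IsContrast.isBoundedScore {ρ : ℝ → ℝ} (hρ : IsContrast ρ) :
    IsBoundedScore (deriv ρ) (supNorm (deriv ρ)) :=
  ⟨hρ.deriv_lipschitz, le_ciSup hρ.deriv_bounded⟩

theorem IsContrast.odd_deriv {ρ : ℝ → ℝ} (hρ : IsContrast ρ) : (deriv ρ).Odd := fun z => by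
  have hderiv := deriv_comp_neg ρ z
  rw [funext hρ.symm] at hderiv
  linarith

/-- The law on `ℝ` with density `g`. -/
def noiseLaw (g : ℝ → ℝ) : Measure ℝ := volume.withDensity fun z => ENNReal.ofReal (g z)

namespace IsSymmMonotoneDensity

variable {g : ℝ → ℝ}

theorem isProbabilityMeasure_noiseLaw (hg : IsSymmMonotoneDensity g) :
    IsProbabilityMeasure (noiseLaw g) :=
  ⟨by rw [noiseLaw, withDensity_apply _ .univ, Measure.restrict_univ, hg.lintegral_eq_one]⟩

theorem isNegInvariant_noiseLaw (hg : IsSymmMonotoneDensity g) : (noiseLaw g).IsNegInvariant := by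
  refine ⟨Measure.ext fun s hs => ?_⟩
  rw [Measure.neg, Measure.map_apply measurable_neg hs, noiseLaw, withDensity_apply _ hs,
    withDensity_apply _ (measurable_neg hs),
    ← (Measure.measurePreserving_neg volume).setLIntegral_comp_preimage hs
      hg.measurable.ennreal_ofReal]
  simp only [hg.symm]

theorem integral_noiseLaw (hg : IsSymmMonotoneDensity g) (φ : ℝ → ℝ) :
    ∫ z, φ z ∂noiseLaw g = ∫ z, φ z * g z := by
  rw [noiseLaw, integral_withDensity_eq_integral_toReal_smul hg.measurable.ennreal_ofReal
    (ae_of_all _ fun _ => ENNReal.ofReal_lt_top)]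
  simp only [ENNReal.toReal_ofReal (hg.nonneg _), smul_eq_mul, mul_comm]

end IsSymmMonotoneDensity

theorem hasScoreSlope_noiseLaw {ρ : ℝ → ℝ} (hρ : IsContrast ρ) {c L α w₀ : ℝ} {n : ℕ}
    {g : Fin n → ℝ → ℝ} (hg : g ∈ densityClass ρ c n) (hL : 0 ≤ L) (hα : 0 ≤ α)
    (hholder : SecondDerivHolder ρ L α g) (hw₀ : L * w₀ ^ α ≤ c / 2) (i : Fin n) :
    HasScoreSlope (deriv ρ) (noiseLaw (g i)) (c / 2) w₀ := by
  have hgi := hg.1 i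
  have _ := hgi.isProbabilityMeasure_noiseLaw
  have _ := hgi.isNegInvariant_noiseLaw
  refine hasScoreSlope_of_holder hρ.isBoundedScore hρ.odd_deriv hL hα (fun u v => ?_) ?_ hw₀
  · rw [hgi.integral_noiseLaw]
    exact hholder i u v
  · rw [hgi.integral_noiseLaw]
    exact hg.2.trans (ciInf_le (Set.finite_range _).bddBelow i)

theorem exists_pos_mul_rpow_eq {L α c : ℝ} (hL : 0 < L) (hα : 0 < α) (hc : 0 < c) :
    ∃ w > 0, L * w ^ α = c := by
  refine ⟨(c / L) ^ (1 / α), by positivity, ?_⟩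
  rw [← Real.rpow_mul (by positivity), one_div_mul_cancel hα.ne', Real.rpow_one,
    mul_div_cancel₀ _ hL.ne']

theorem IsDesignNoise.isSample {Ω : Type*} [MeasurableSpace Ω] {P : Measure Ω}
    [IsProbabilityMeasure P] {d n : ℕ} {g : Fin n → ℝ → ℝ} {X : Fin n → Ω → Fin d → ℝ}
    {ξ : Fin n → Ω → ℝ} (hD : IsDesignNoise P g X ξ) :
    IsSample P (fun i => noiseLaw (g i)) fun i ω => (X i ω, ξ i ω) where
  measurable i := (hD.measurable_design i).prodMk (hD.measurable_noise i)
  law i := by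
    rw [(indepFun_iff_map_prod_eq_prod_map_map (hD.measurable_design i).aemeasurable
      (hD.measurable_noise i).aemeasurable).1
        (hD.indep.comp (measurable_pi_apply i) (measurable_pi_apply i)),
      hD.law_design, hD.law_noise, obsLaw, noiseLaw]
  indep := iIndepFun_prodMk hD.measurable_design hD.measurable_noise hD.indep_design
    hD.indep_noise hD.indep

theorem abs_sub_localPoly_le_bias {d b : ℕ} {f : (Fin d → ℝ) → ℝ} {x₀ : Fin d → ℝ} {h : ℝ}
    (hbias : BddAbove (biasValues b f x₀ h)) :
    ∀ x ∈ nbhd x₀ h, |f x - localPoly x₀ h (taylorCoeff (b := b) f x₀ h) x| ≤ bias b f x₀ h :=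
  fun x hx => le_csSup hbias ⟨x, hx, rfl⟩

theorem taylorCoeff_zeroIdx {d b : ℕ} (f : (Fin d → ℝ) → ℝ) (x₀ : Fin d → ℝ) (h : ℝ) :
    taylorCoeff f x₀ h (zeroIdx d b) = f x₀ := by
  have hdir : directions (0 : Fin d → ℕ) = [] := by simp [directions]
  simp [taylorCoeff, hdir, IterPartialExists, iterPartial, zeroIdx]

theorem abs_apply_zeroIdx_sub_le {d b : ℕ} (f : (Fin d → ℝ) → ℝ) (x₀ : Fin d → ℝ) (h : ℝ)
    (t : multiIdx d b → ℝ) :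
    |t (zeroIdx d b) - f x₀| ≤ √(∑ p, (t p - taylorCoeff f x₀ h p) ^ 2) := by
  rw [← taylorCoeff_zeroIdx (b := b) f x₀ h]
  exact abs_le_sqrt_sum_sq (t - taylorCoeff f x₀ h) (zeroIdx d b)

end LocalM

end

theorem proposition1_general {d : ℕ} (b : ℕ) {K : (Fin d → ℝ) → ℝ} (hK : LocalM.IsKernel K)
    {ρ : ℝ → ℝ} (hconv : ConvexOn ℝ Set.univ ρ) (hdiff : Differentiable ℝ ρ) {R : ℝ}
    (hscore : LocalM.IsBoundedScore (deriv ρ) R) {c w₀ : ℝ} (hc : 0 < c) (hw₀ : 0 < w₀) :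
    ∃ δ > 0, ∀ (n : ℕ), 0 < n →
      ∀ (ν : Fin n → Measure ℝ) [∀ i, IsProbabilityMeasure (ν i)],
      (∀ i, LocalM.HasScoreSlope (deriv ρ) (ν i) (c / 2) w₀) →
      ∀ {x₀ : Fin d → ℝ} {h : ℝ}, LocalM.IsWindow K x₀ h →
      ∀ {M : ℝ} {θ : LocalM.multiIdx d b → ℝ}, θ ∈ LocalM.paramSet d b M →
      ∀ {f : (Fin d → ℝ) → ℝ}, Measurable f →
      ∀ {β : ℝ}, (∀ x ∈ LocalM.nbhd x₀ h, |f x - LocalM.localPoly x₀ h θ x| ≤ β) →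
      ∀ {Ω : Type*} [MeasurableSpace Ω] {P : Measure Ω} [IsProbabilityMeasure P]
        {Z : Fin n → Ω → (Fin d → ℝ) × ℝ}, LocalM.IsSample P ν Z →
      ∀ {θhat : Ω → LocalM.multiIdx d b → ℝ},
      (∀ ω, LocalM.IsLocalMEstimate ρ K M x₀ h (fun i => (Z i ω).1)
        (fun i => f (Z i ω).1 + (Z i ω).2) (θhat ω)) →
      ∀ {ε : ℝ},
      4 * LocalM.numIdx d b / (c * LocalM.minEigen b K) * max 1 (β * √(n * h ^ d)) ≤ ε →
      P.real {ω | ε ≤ √(n * h ^ d) * √(∑ p, (θhat ω p - θ p) ^ 2) ∧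
          θhat ω ∈ LocalM.paramBall M θ δ} ≤
        LocalM.deviationBound (LocalM.numIdx d b) 6 c (LocalM.minEigen b K)
          (LocalM.supNorm K) R (n * h ^ d) β ε := by
  have hlam := hK.minEigen_pos (b := b)
  have hN := LocalM.one_le_numIdx d b
  obtain ⟨γ, hγ⟩ : ∃ γ, γ = c / 2 * LocalM.minEigen b K / LocalM.numIdx d b := ⟨_, rfl⟩
  obtain ⟨F, hF1, hF⟩ := LocalM.exists_finset_sphere_net (LocalM.multiIdx d b) (η := γ / 24)
    (by rw [hγ]; positivity)
  obtain ⟨δ, hδ0, hδ⟩ := LocalM.exists_isLocalizationRadius (LocalM.numIdx d b)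
    (LocalM.supNorm K) γ hw₀ F.card
  refine ⟨δ, hδ0, fun n hn ν _ hslope x₀ h hw M θ hθ f hf β hβ Ω _ P _ Z hZ θhat hθhat ε
    hε => ?_⟩
  have hε0 : 0 < ε := lt_of_lt_of_le (by positivity) hε
  have hγε : γ * ε = c * LocalM.minEigen b K / (2 * LocalM.numIdx d b) * ε := by
    rw [hγ]
    ring
  have hbound := hZ.measureReal_far_estimate_le hn hconv hdiff
    (R := max 1 R) ⟨hscore.lipschitz, fun z => (hscore.abs_le z).trans (le_max_right _ _)⟩
    (le_max_left _ _) hw hf (half_pos hc).le hslope hβ hθ hγ hF1 hF hδ hθhat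
    (le_max_left 1 _) (le_max_right _ _) (by
      rw [div_mul_eq_mul_div, div_le_iff₀ (by positivity)] at hε
      rw [hγε, div_mul_eq_mul_div, le_div_iff₀ (by positivity)]
      linarith) hε0
  rw [LocalM.deviationBound_eq hscore.nonneg, ← hγε]
  refine hbound.trans ?_
  gcongr
  linarith

theorem proposition1 {d : ℕ} (hd : 0 < d) (b : ℕ)
    (K : (Fin d → ℝ) → ℝ) (hK : LocalM.IsKernel K)
    (ρ : ℝ → ℝ) (hρ : LocalM.IsContrast ρ) (L α : ℝ) (hL : 0 < L) (hα : 0 < α)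
    (c : ℝ) (hc : 0 < c) :
    ∃ δ : ℝ, 0 < δ ∧
      ∀ (n : ℕ), 0 < n →
      ∀ g ∈ LocalM.densityClass ρ c n, LocalM.SecondDerivHolder ρ L α g →
      ∀ (h : ℝ), (n : ℝ) ^ (-(1 : ℝ) / d) < h →
      ∀ (M : ℝ), 0 < M →
      ∀ x₀ ∈ LocalM.unitCube d,
      -- the kernel window lies in the domain of the regression function
      (∀ z, K z ≠ 0 → x₀ + h • z ∈ LocalM.unitCube d) →
      ∀ (f : (Fin d → ℝ) → ℝ), Measurable f →
      LocalM.taylorCoeff f x₀ h ∈ LocalM.paramSet d b M →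
      BddAbove (LocalM.biasValues b f x₀ h) →
      ∀ (Ω : Type*) [MeasurableSpace Ω] (P : Measure Ω) [IsProbabilityMeasure P]
        (X : Fin n → Ω → Fin d → ℝ) (ξ : Fin n → Ω → ℝ), LocalM.IsDesignNoise P g X ξ →
      ∀ (θhat : Ω → LocalM.multiIdx d b → ℝ),
      (∀ ω, LocalM.IsLocalMEstimate ρ K M x₀ h
        (fun i => X i ω) (fun i => f (X i ω) + ξ i ω) (θhat ω)) →
      ∀ (ε : ℝ),
      4 * LocalM.numIdx d b / (c * LocalM.minEigen b K) *
          max 1 (LocalM.bias b f x₀ h * √(n * h ^ d)) ≤ ε →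
      P.real {ω | ε ≤ √(n * h ^ d) * |θhat ω (LocalM.zeroIdx d b) - f x₀| ∧
          θhat ω ∈ LocalM.paramBall M (LocalM.taylorCoeff f x₀ h) δ} ≤
        LocalM.deviationBound (LocalM.numIdx d b)
          (LocalM.sigmaConst d (LocalM.supNorm K)) c (LocalM.minEigen b K)
          (LocalM.supNorm K) (LocalM.supNorm (deriv ρ)) (n * h ^ d)
          (LocalM.bias b f x₀ h) ε := by
  obtain ⟨w₀, hw₀, hLw⟩ := LocalM.exists_pos_mul_rpow_eq hL hα (half_pos hc)
  obtain ⟨δ, hδ, hfar⟩ := proposition1_general b hK hρ.convex hρ.differentiable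
    hρ.isBoundedScore hc hw₀
  refine ⟨δ, hδ, fun n hn g hg hholder h hh M _ x₀ _ hwin f hf hθ hbias Ω _ P _ X ξ hD θhat hθhat
    ε hε => ?_⟩
  have hw : LocalM.IsWindow K x₀ h := ⟨hK, lt_of_le_of_lt (by positivity) hh, hwin⟩
  have _ (i : Fin n) := (hg.1 i).isProbabilityMeasure_noiseLaw
  calc P.real _ ≤ _ := by
        refine measureReal_mono fun ω hω => ⟨hω.1.trans ?_, hω.2⟩
        gcongr
        exact LocalM.abs_apply_zeroIdx_sub_le f x₀ h (θhat ω)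
    _ ≤ _ := hfar n hn (fun i => LocalM.noiseLaw (g i))
        (LocalM.hasScoreSlope_noiseLaw hρ hg hL.le hα.le hholder hLw.le) hw hθ hf
        (LocalM.abs_sub_localPoly_le_bias hbias) hD.isSample hθhat hε
    _ ≤ _ := LocalM.deviationBound_le_deviationBound (Nat.cast_nonneg _)
        (LocalM.six_le_sigmaConst hd hK.one_le_supNorm)
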